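/- **Model.** For every $n$ there is a cluster of $n$ workers; worker $i\in[n]$ has parameters $a_i,\mu_i,\alpha_i$ (which may depend on $n$), and $r=r_n\in\mathbb N$ inner products are needed. Assume $a_i,\mu_i,\alpha_i=\Theta(1)$, i.e. all of them lie between two positive constants not depending on $n$ and $i$, and $r=\Theta(n)$. For a load allocation $\ell=(\ell_1,\dots,\ell_n)\in[0,\infty)^n$ the run-times $T_1,\dots,T_n$ of the workers are independent and shifted Weibull, $$\Pr[T_i\le t]=1-e^{-\left(\frac{\mu_i}{\ell_i}(t-a_i\ell_i)\right)^{\alpha_i}}\quad\text{for } t\ge a_i\ell_i \text{ and } \ell_i>0$$ (workers with load $0$ contribute nothing). The aggregate return is $X(t)=\sum_i \ell_i\mathbb 1_{\{T_i\le t\}}$, and the completion time is $T_{\mathsf{CMP}}=\inf\{t\ge 0: X(t)\ge r\}\in[0,\infty]$. An optimal allocation $\ell_{\mathsf{OPT}}$ minimizes $\mathbb E[T_{\mathsf{CMP}}]$ over $[0,\infty)^n$; its completion time is $T_{\mathsf{OPT}}$. **HCMM.** For $t>0$ let $\ell^*(t)$ be a maximizer of $\mathbb E[X(t)]$ over $[0,\infty)^n$,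 and let $X^*(t)$ be the aggregate return at time $t$ under the loads $\ell^*(t)$. A sequence of times $t=t_n>0$ is feasible if $\Pr[X^*(t_n)<r]=o(1/n)$. Let $t^*=t^*_n$ be a smallest feasible sequence up to $o(1)$: it is feasible, and $t^*_n\le t_n+o(1)$ in the sense that for every feasible sequence $(t_n)$ and every $\varepsilon>0$ one has $t^*_n\le t_n+\varepsilon$ for all large $n$. HCMM uses the loads $\ell^*(t^*)$; its completion time is $T_{\mathsf{HCMM}}$. **Theorem 3.** 1. For every worker there is exactly one $\lambda_i>a_i$ with $e^{\mu_i^{\alpha_i}(\lambda_i-a_i)^{\alpha_i}}=1+\alpha_i\mu_i^{\alpha_i}\lambda_i(\lambda_i-a_i)^{\alpha_i-1}$, and for every $t>0$ the unique maximizer of $\mathbb E[X(t)]$ is $\ell_i^*(t)=t/\lambda_i$, so that the HCMM loads are $\ell_i^*(t^*)=t^*/\lambda_i$. 2. A sequence $t^*$ as above exists, and for every $n$ there is an optimal allocation. 3. HCMM is asymptotically optimal: for every such $t^*$ and all optimal allocations, $\mathbb E[T_{\mathsf{HCMM}}]$ and $\mathbb E[T_{\mathsf{OPT}}]$ are finite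 for all large $n$, and $\lim_{n\to\infty}\big(\mathbb E[T_{\mathsf{HCMM}}]-\mathbb E[T_{\mathsf{OPT}}]\big)=0$; in particular, if one of the two expectations has a limit as $n\to\infty$, then so does the other, and $\lim_{n\to\infty}\mathbb E[T_{\mathsf{HCMM}}]=\lim_{n\to\infty}\mathbb E[T_{\mathsf{OPT}}]$. -/

import Mathlib

open MeasureTheory ProbabilityTheory Filter Asymptotics
open scoped ENNReal NNReal Topology

/-- The shifted Weibull law of the run-time of a worker with shift parameter `a`, straggling
parameter `μ` and shape parameter `α`, loaded with `ℓ` rows: the law of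
`a ℓ + (ℓ / μ) E ^ (1 / α)` for a standard exponential variable `E`.  For `ℓ > 0` its CDF is
`t ↦ 1 - exp (-((μ / ℓ) (t - a ℓ)) ^ α)` on `t ≥ a ℓ` (see `shiftedWeibull_Iic`); for `ℓ = 0` it is
the point mass at `0`. -/
noncomputable def shiftedWeibull (a μ α ℓ : ℝ) : Measure ℝ :=
  (expMeasure 1).map fun x => a * ℓ + ℓ / μ * x ^ (1 / α)

theorem measurable_shiftedWeibull_map (a μ α ℓ : ℝ) :
    Measurable fun x : ℝ => a * ℓ + ℓ / μ * x ^ (1 / α) := by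
  fun_prop

instance (a μ α ℓ : ℝ) : IsProbabilityMeasure (shiftedWeibull a μ α ℓ) := by
  have : IsProbabilityMeasure (expMeasure 1) := isProbabilityMeasure_expMeasure one_pos
  exact Measure.isProbabilityMeasure_map (measurable_shiftedWeibull_map a μ α ℓ).aemeasurable

/-- The CDF of the shifted Weibull law. -/
theorem shiftedWeibull_Iic {a μ α ℓ t : ℝ} (hμ : 0 < μ) (hα : 0 < α) (hℓ : 0 < ℓ)
    (ht : a * ℓ ≤ t) :
    (shiftedWeibull a μ α ℓ).real (Set.Iic t) = 1 - Real.exp (-((μ / ℓ * (t - a * ℓ)) ^ α)) := by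
  have : IsProbabilityMeasure (expMeasure 1) := isProbabilityMeasure_expMeasure one_pos
  have hz : 0 ≤ μ / ℓ * (t - a * ℓ) := mul_nonneg (by positivity) (by linarith)
  have hy : 0 ≤ (μ / ℓ * (t - a * ℓ)) ^ α := Real.rpow_nonneg hz α
  have h0 : expMeasure 1 (Set.Iic 0) = 0 := by
    have h := cdf_expMeasure_eq one_pos 0
    rw [cdf_eq_real] at h
    simpa [measureReal_def, ENNReal.toReal_eq_zero_iff] using h
  have hae : ∀ᵐ x ∂(expMeasure 1), 0 < x := by
    rw [ae_iff]
    simpa [Set.Iic] using h0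
  have hc := cdf_expMeasure_eq one_pos ((μ / ℓ * (t - a * ℓ)) ^ α)
  rw [cdf_eq_real, if_pos hy, one_mul] at hc
  rw [shiftedWeibull, map_measureReal_apply (measurable_shiftedWeibull_map a μ α ℓ)
    measurableSet_Iic, ← hc]
  refine measureReal_congr ?_
  filter_upwards [hae] with x hx
  refine propext ?_
  change a * ℓ + ℓ / μ * x ^ (1 / α) ≤ t ↔ x ≤ (μ / ℓ * (t - a * ℓ)) ^ α
  rw [one_div, ← Real.rpow_inv_le_iff_of_pos hx.le hz hα]
  have hm : μ / ℓ * (ℓ / μ) = 1 := by field_simp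
  have hp : 0 < μ / ℓ := by positivity
  rw [← mul_le_mul_iff_right₀ hp (b := a * ℓ + ℓ / μ * x ^ α⁻¹)]
  constructor <;> intro h
  · linear_combination h - x ^ α⁻¹ * hm
  · linear_combination h + x ^ α⁻¹ * hm

section Model

variable {n : ℕ}

/-- The joint law of the independent run-times `T₁, …, Tₙ` under the load allocation `ℓ`. -/
noncomputable def runTimeLaw (a μ α ℓ : Fin n → ℝ) : Measure (Fin n → ℝ) :=
  Measure.pi fun i => shiftedWeibull (a i) (μ i) (α i) (ℓ i)

/-- The aggregate return `X(t) = ∑ ℓᵢ 𝟙{Tᵢ ≤ t}`: the number of inner products received by the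
master by time `t`, when worker `i` has load `ℓ i` and finishes at time `T i`. -/
noncomputable def aggregateReturn (ℓ T : Fin n → ℝ) (t : ℝ) : ℝ :=
  ∑ i, if T i ≤ t then ℓ i else 0

/-- The waiting time `T_CMP` until at least `r` inner products have been received
(`∞` if this never happens). -/
noncomputable def completionTime (r : ℕ) (ℓ T : Fin n → ℝ) : ℝ≥0∞ :=
  ⨅ (t : ℝ≥0) (_ : (r : ℝ) ≤ aggregateReturn ℓ T t), (t : ℝ≥0∞)

/-- `E[T_CMP]` under the load allocation `ℓ`. -/
noncomputable def expectedCompletionTime (a μ α : Fin n → ℝ) (r : ℕ) (ℓ : Fin n → ℝ) : ℝ≥0∞ :=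
  ∫⁻ T, completionTime r ℓ T ∂(runTimeLaw a μ α ℓ)

/-- `ℓ` is an optimal load allocation: it minimizes `E[T_CMP]` over all nonnegative load
allocations. -/
def IsOptimalAllocation (a μ α : Fin n → ℝ) (r : ℕ) (ℓ : Fin n → ℝ) : Prop :=
  (∀ i, 0 ≤ ℓ i) ∧ ∀ ℓ' : Fin n → ℝ, (∀ i, 0 ≤ ℓ' i) →
    expectedCompletionTime a μ α r ℓ ≤ expectedCompletionTime a μ α r ℓ'

/-- `E[X(t)]` under the load allocation `ℓ`. -/
noncomputable def expectedReturn (a μ α ℓ : Fin n → ℝ) (t : ℝ) : ℝ :=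
  ∫ T, aggregateReturn ℓ T t ∂(runTimeLaw a μ α ℓ)

/-- `ℓ` maximizes the expected aggregate return `E[X(t)]` at time `t` over all nonnegative load
allocations. -/
def IsReturnMaximizer (a μ α : Fin n → ℝ) (t : ℝ) (ℓ : Fin n → ℝ) : Prop :=
  (∀ i, 0 ≤ ℓ i) ∧ ∀ ℓ' : Fin n → ℝ, (∀ i, 0 ≤ ℓ' i) →
    expectedReturn a μ α ℓ' t ≤ expectedReturn a μ α ℓ t

end Model

/-- `lam > a` solves
`exp (μ ^ α (lam - a) ^ α) = 1 + α μ ^ α lam (lam - a) ^ (α - 1)`. -/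
def IsHCMMRate (a μ α lam : ℝ) : Prop :=
  a < lam ∧ Real.exp (μ ^ α * (lam - a) ^ α) = 1 + α * μ ^ α * lam * (lam - a) ^ (α - 1)

/-- The times `t n > 0` and load allocations `ℓ n` (for the clusters of `n` workers, `n ∈ ℕ`) satisfy
the constraints of the alternative problem: `ℓ n` maximizes the expected aggregate return at time
`t n`, and with these loads `Pr[X(t n) < r n] = o(1 / n)`. -/
def IsAltFeasible (a μ α : (n : ℕ) → Fin n → ℝ) (r : ℕ → ℕ) (t : ℕ → ℝ)
    (ℓ : (n : ℕ) → Fin n → ℝ) : Prop :=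
  (∀ n, 0 < t n) ∧
  (∀ n, IsReturnMaximizer (a n) (μ n) (α n) (t n) (ℓ n)) ∧
  (fun n => (runTimeLaw (a n) (μ n) (α n) (ℓ n)).real
      {T | aggregateReturn (ℓ n) T (t n) < (r n : ℝ)}) =o[atTop] fun n => 1 / (n : ℝ)

/-- `(t, ℓ)` solves the alternative problem, so that `ℓ` is the HCMM load allocation: it satisfies
the constraints, and `t` is asymptotically smallest among all feasible times.  The constraint
`o(1 / n)` restricts only the whole sequence of times, so that minimality has to be understood up to
`o(1)`. -/
def IsHCMM (a μ α : (n : ℕ) → Fin n → ℝ) (r : ℕ → ℕ) (t : ℕ → ℝ)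
    (ℓ : (n : ℕ) → Fin n → ℝ) : Prop :=
  IsAltFeasible a μ α r t ℓ ∧
  ∀ (t' : ℕ → ℝ) (ℓ' : (n : ℕ) → Fin n → ℝ), IsAltFeasible a μ α r t' ℓ' →
    ∀ ε > 0, ∀ᶠ n in atTop, t n ≤ t' n + ε

/-- `xᵢ = Θ(1)`: the parameters of all workers lie between two positive constants that do not depend
on the number `n` of workers. -/
def IsThetaOne (x : (n : ℕ) → Fin n → ℝ) : Prop :=
  ∃ c C : ℝ, 0 < c ∧ ∀ (n : ℕ) (i : Fin n), c ≤ x n i ∧ x n i ≤ C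

/-! ### The HCMM rate and the best return per unit of time -/

section HCMMRate

/-! Both expected completion times equal `criticalTime` + o(1), so they are compared with that
number and not with each other.

By scaling, a worker with load `t / y` has expected return `t * returnRate y` at time `t`. The
derivative of `returnRate` is a negative multiple of the strictly increasing `hcmmRateGap`, whose
only zero is the HCMM rate `lam`; hence `t / lam` is the unique best load. The best expected total
return is `t * S`, with `S` the sum of the maximal rates, which is at least `n * g`. It reaches `r`
at the critical time τ = `r / S` = O(1).

A worker that has finished by time `t` has load at most `t / a`, so for arbitrary loads the return
is a sum of independent variables bounded by a constant. Hoeffding's inequality then gives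
fluctuations of order √n, while moving `t` by δ moves `t * S` by at least `δ * n * g`.

Lower bound: at time τ - δ every allocation falls short of `r` with probability tending to 1, so
every expected completion time is at least τ - o(1) (`eventually_le_expectedCompletionTime`).

Upper bound: τ + (n + 1)^(-1/4) is a feasible time, so the HCMM time is at most τ + o(1). On the
event B of a shortfall the completion time is at most the sum of the run-times. Each run-time is
independent of the other returns, so its integral over B is O(P(B)), and the sum is n O(P(B)) = o(1)
by the constraint o(1/n) (`expectedCompletionTime_le`, `eventually_expectedCompletionTime_le`).

An optimal allocation exists because loads may be truncated at `r` and, on the resulting compact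
box, the expectation is lower semicontinuous by Fatou's lemma. -/

theorem strictMonoOn_exp_sub_one_div :
    StrictMonoOn (fun u : ℝ => (Real.exp u - 1) / u) (Set.Ioi 0) := by
  intro u hu v hv huv
  have h := strictConvexOn_exp.secant_strict_mono (Set.mem_univ 0) (Set.mem_univ u)
    (Set.mem_univ v) (ne_of_gt hu) (ne_of_gt hv) huv
  simpa using h

/-- The function whose zero on `(a, ∞)` is the HCMM rate. -/
noncomputable def hcmmRateGap (a μ α x : ℝ) : ℝ :=
  (Real.exp ((μ * (x - a)) ^ α) - 1) / (μ * (x - a)) ^ α - α * x / (x - a)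

variable {a μ α : ℝ}

/-- Secant slopes of `exp` at 0 increase, while `α * x / (x - a)` is α + αa / (x - a) and decreases.
-/
theorem strictMonoOn_hcmmRateGap (ha : 0 < a) (hμ : 0 < μ) (hα : 0 < α) :
    StrictMonoOn (hcmmRateGap a μ α) (Set.Ioi a) := by
  intro x hx y hy hxy
  have hx' : 0 < x - a := sub_pos.2 hx
  have hy' : 0 < y - a := sub_pos.2 hy
  have h1 : (μ * (x - a)) ^ α < (μ * (y - a)) ^ α :=
    Real.rpow_lt_rpow (by positivity) (by gcongr) hα
  have h2 := strictMonoOn_exp_sub_one_div (a := (μ * (x - a)) ^ α) (b := (μ * (y - a)) ^ α)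
    (Set.mem_Ioi.2 (by positivity)) (Set.mem_Ioi.2 (by positivity)) h1
  have h3 : α * y / (y - a) < α * x / (x - a) := by
    rw [div_lt_div_iff₀ hy' hx']
    have : 0 < α * a * (y - x) := mul_pos (by positivity) (by linarith)
    nlinarith
  simp only at h2
  unfold hcmmRateGap
  linarith

theorem continuousOn_hcmmRateGap (hμ : 0 < μ) :
    ContinuousOn (hcmmRateGap a μ α) (Set.Ioi a) := by
  intro x hx
  have hx' : 0 < x - a := sub_pos.2 hx
  have h : 0 < μ * (x - a) := by positivity
  refine ContinuousAt.continuousWithinAt ?_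
  have hc : ContinuousAt (fun x => (μ * (x - a)) ^ α) x :=
    ContinuousAt.rpow_const (by fun_prop) (Or.inl h.ne')
  exact ((hc.rexp.sub continuousAt_const).div hc (by positivity)).sub
    (ContinuousAt.div (by fun_prop) (by fun_prop) hx'.ne')

theorem isHCMMRate_iff (hμ : 0 < μ) {x : ℝ} :
    IsHCMMRate a μ α x ↔ a < x ∧ hcmmRateGap a μ α x = 0 := by
  refine and_congr_right fun hx => ?_
  have hx' : 0 < x - a := sub_pos.2 hx
  have hu : 0 < μ ^ α * (x - a) ^ α := by positivity
  rw [hcmmRateGap, Real.mul_rpow hμ.le hx'.le, Real.rpow_sub_one hx'.ne', sub_eq_zero,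
    div_eq_div_iff hu.ne' hx'.ne', ← sub_eq_zero, ← sub_eq_zero (a := _ * (x - a))]
  have : (Real.exp (μ ^ α * (x - a) ^ α) - 1) * (x - a) - α * x * (μ ^ α * (x - a) ^ α) =
      (x - a) * (Real.exp (μ ^ α * (x - a) ^ α) -
        (1 + α * μ ^ α * x * ((x - a) ^ α / (x - a)))) := by
    field_simp
    ring
  rw [this, mul_eq_zero, or_iff_right hx'.ne']

theorem exists_hcmmRateGap_eq_zero (ha : 0 < a) (hμ : 0 < μ) (hα : 0 < α) :
    ∃ x, a < x ∧ hcmmRateGap a μ α x = 0 := by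
  -- `μ * δ ≤ 1` keeps the secant slope below e - 1 < 2, and `2 * δ ≤ α * a` makes the subtracted
  -- quotient at least 2.
  obtain ⟨δ, hδ, hδ1, hδ2⟩ : ∃ δ : ℝ, 0 < δ ∧ μ * δ ≤ 1 ∧ 2 * δ ≤ α * a := by
    refine ⟨min (1 / μ) (α * a / 2), by positivity, ?_, ?_⟩
    · calc _ ≤ μ * (1 / μ) := by gcongr; exact min_le_left _ _
        _ = 1 := by field_simp
    · calc _ ≤ 2 * (α * a / 2) := by gcongr; exact min_le_right _ _
        _ = α * a := by ring
  have hlow : hcmmRateGap a μ α (a + δ) ≤ 0 := by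
    have hu : 0 < (μ * δ) ^ α := by positivity
    have hu1 : (μ * δ) ^ α ≤ 1 := Real.rpow_le_one (by positivity) hδ1 hα.le
    have h1 : (Real.exp ((μ * δ) ^ α) - 1) / (μ * δ) ^ α ≤ Real.exp 1 - 1 := by
      have := strictMonoOn_exp_sub_one_div.monotoneOn (Set.mem_Ioi.2 hu)
        (Set.mem_Ioi.2 one_pos) hu1
      simpa using this
    have h2 : 2 ≤ α * (a + δ) / δ := by
      rw [le_div_iff₀ hδ]
      nlinarith [mul_pos hα hδ]
    have := Real.exp_one_lt_d9
    simp only [hcmmRateGap, add_sub_cancel_left]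
    linarith
  -- Far out the secant slope at u is at least u / 2, while the quotient stays below its value at `a
  -- + δ`.
  obtain ⟨D, hDδ, hD⟩ : ∃ D, δ ≤ D ∧ 0 ≤ hcmmRateGap a μ α (a + D) := by
    have ht : Tendsto (fun D : ℝ => (μ * D) ^ α) atTop atTop :=
      (tendsto_rpow_atTop hα).comp (tendsto_id.const_mul_atTop hμ)
    obtain ⟨D, h1, h2⟩ := ((ht.eventually_ge_atTop (2 * (α * (a + δ) / δ))).and
      (eventually_ge_atTop δ)).exists
    refine ⟨D, h2, ?_⟩
    have hD0 : 0 < D := hδ.trans_le h2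
    have hu : 0 < (μ * D) ^ α := by positivity
    have h3 : (μ * D) ^ α / 2 ≤ (Real.exp ((μ * D) ^ α) - 1) / (μ * D) ^ α := by
      rw [le_div_iff₀ hu]
      nlinarith [Real.quadratic_le_exp_of_nonneg hu.le]
    have h4 : α * (a + D) / D ≤ α * (a + δ) / δ := by
      rw [div_le_div_iff₀ hD0 hδ]
      nlinarith [mul_nonneg (mul_pos hα ha).le (sub_nonneg.2 h2)]
    simp only [hcmmRateGap, add_sub_cancel_left]
    linarith
  have hsub : Set.Icc (a + δ) (a + D) ⊆ Set.Ioi a := fun x hx =>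
    Set.mem_Ioi.2 (by linarith [hx.1])
  obtain ⟨x, hx, h0⟩ := intermediate_value_Icc (by linarith : a + δ ≤ a + D)
    ((continuousOn_hcmmRateGap (α := α) hμ).mono hsub) ⟨hlow, hD⟩
  exact ⟨x, hsub hx, h0⟩

theorem existsUnique_isHCMMRate (ha : 0 < a) (hμ : 0 < μ) (hα : 0 < α) :
    ∃ lam, ∀ x, IsHCMMRate a μ α x ↔ x = lam := by
  obtain ⟨lam, h1, h2⟩ := exists_hcmmRateGap_eq_zero ha hμ hα
  refine ⟨lam, fun x => ?_⟩
  rw [isHCMMRate_iff hμ]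
  constructor
  · rintro ⟨h3, h4⟩
    exact (strictMonoOn_hcmmRateGap ha hμ hα).injOn h3 h1 (h4.trans h2.symm)
  · rintro rfl
    exact ⟨h1, h2⟩

/-- The expected return per unit of time of a worker with load `t / y` at time `t`. -/
noncomputable def returnRate (a μ α y : ℝ) : ℝ :=
  (1 - Real.exp (-(μ * (y - a)) ^ α)) / y

theorem hasDerivAt_returnRate (ha : 0 < a) (hμ : 0 < μ) {y : ℝ} (hy : a < y) :
    HasDerivAt (returnRate a μ α)
      (-(Real.exp (-(μ * (y - a)) ^ α) * (μ * (y - a)) ^ α / y ^ 2 * hcmmRateGap a μ α y)) y := by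
  have hy' : 0 < y - a := sub_pos.2 hy
  have hy0 : 0 < y := ha.trans hy
  have hv : 0 < μ * (y - a) := by positivity
  have h1 : HasDerivAt (fun y : ℝ => μ * (y - a)) μ y := by
    simpa using ((hasDerivAt_id y).sub_const a).const_mul μ
  have h2 := h1.rpow_const (p := α) (Or.inl hv.ne')
  have h3 := ((h2.neg.exp).const_sub 1).div (hasDerivAt_id y) hy0.ne'
  refine h3.congr_deriv ?_
  have hu : 0 < (μ * (y - a)) ^ α := by positivity
  have he : Real.exp (-(μ * (y - a)) ^ α) * Real.exp ((μ * (y - a)) ^ α) = 1 := by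
    rw [← Real.exp_add]; simp
  simp only [Pi.neg_apply, id]
  rw [hcmmRateGap, Real.rpow_sub_one hv.ne']
  generalize Real.exp (-(μ * (y - a)) ^ α) = e at *
  generalize Real.exp ((μ * (y - a)) ^ α) = f at *
  generalize (μ * (y - a)) ^ α = u at *
  field_simp
  linear_combination (y - a) * he

/-- The gap changes sign from negative to positive at `lam`, so the return rate increases before
`lam` and decreases after it. -/
theorem returnRate_lt (ha : 0 < a) (hμ : 0 < μ) (hα : 0 < α) {lam y : ℝ}
    (hlam : IsHCMMRate a μ α lam) (hy : a < y) (hne : y ≠ lam) :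
    returnRate a μ α y < returnRate a μ α lam := by
  obtain ⟨hl, h0⟩ := (isHCMMRate_iff hμ).1 hlam
  have hmono := strictMonoOn_hcmmRateGap ha hμ hα
  have hpos : ∀ x, a < x → 0 < Real.exp (-(μ * (x - a)) ^ α) * (μ * (x - a)) ^ α / x ^ 2 := by
    intro x hx
    have : 0 < x - a := sub_pos.2 hx
    have : 0 < x := ha.trans hx
    positivity
  have hcont : ∀ x, a < x → ContinuousAt (returnRate a μ α) x := fun x hx =>
    (hasDerivAt_returnRate ha hμ hx).continuousAt
  rcases lt_or_gt_of_ne hne with h | h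
  · refine strictMonoOn_of_deriv_pos (convex_Icc y lam)
      (fun x hx => (hcont x (hy.trans_le hx.1)).continuousWithinAt) ?_
      (Set.left_mem_Icc.2 h.le) (Set.right_mem_Icc.2 h.le) h
    intro x hx
    rw [interior_Icc] at hx
    have hx1 := hy.trans hx.1
    rw [(hasDerivAt_returnRate ha hμ hx1).deriv, ← mul_neg]
    exact mul_pos (hpos x hx1) (neg_pos.2 (h0 ▸ hmono hx1 hl hx.2))
  · refine strictAntiOn_of_deriv_neg (convex_Icc lam y)
      (fun x hx => (hcont x (hl.trans_le hx.1)).continuousWithinAt) ?_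
      (Set.left_mem_Icc.2 h.le) (Set.right_mem_Icc.2 h.le) h
    intro x hx
    rw [interior_Icc] at hx
    have hx1 := hl.trans hx.1
    rw [(hasDerivAt_returnRate ha hμ hx1).deriv, neg_lt_zero]
    exact mul_pos (hpos x hx1) (h0 ▸ hmono hl hx1 hx.1)

end HCMMRate

/-! ### Expected return of a single worker -/

section ShiftedWeibull

variable {a μ α ℓ t : ℝ}

theorem ae_expMeasure_one_pos : ∀ᵐ x ∂(expMeasure 1), 0 < x := by
  have : IsProbabilityMeasure (expMeasure 1) := isProbabilityMeasure_expMeasure one_pos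
  have h := cdf_expMeasure_eq one_pos 0
  rw [cdf_eq_real] at h
  have h0 : expMeasure 1 (Set.Iic 0) = 0 := by
    simpa [measureReal_def, ENNReal.toReal_eq_zero_iff] using h
  rw [ae_iff]
  simpa [Set.Iic] using h0

theorem ae_shiftedWeibull_ge (hμ : 0 < μ) (hℓ : 0 ≤ ℓ) :
    ∀ᵐ x ∂(shiftedWeibull a μ α ℓ), a * ℓ ≤ x := by
  rw [shiftedWeibull, ae_map_iff (measurable_shiftedWeibull_map a μ α ℓ).aemeasurable
    measurableSet_Ici]
  filter_upwards [ae_expMeasure_one_pos] with x hx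
  have : 0 ≤ ℓ / μ * x ^ (1 / α) := by positivity
  linarith

theorem shiftedWeibull_Iic_of_le (hμ : 0 < μ) (hα : 0 < α) (hℓ : 0 < ℓ) (ht : t ≤ a * ℓ) :
    (shiftedWeibull a μ α ℓ).real (Set.Iic t) = 0 := by
  have h : (shiftedWeibull a μ α ℓ).real (Set.Iic (a * ℓ)) = 0 := by
    rw [shiftedWeibull_Iic hμ hα hℓ le_rfl]
    simp [Real.zero_rpow hα.ne']
  exact le_antisymm ((measureReal_mono (Set.Iic_subset_Iic.2 ht)).trans h.le) measureReal_nonneg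

/-- Scale invariance: the probability of finishing by `t` depends on `t` and `ℓ` only through `t /
ℓ`. -/
theorem load_mul_shiftedWeibull_Iic (hμ : 0 < μ) (hα : 0 < α) (hℓ : 0 < ℓ) (ht0 : 0 < t)
    (ht : a * ℓ ≤ t) :
    ℓ * (shiftedWeibull a μ α ℓ).real (Set.Iic t) = t * returnRate a μ α (t / ℓ) := by
  rw [shiftedWeibull_Iic hμ hα hℓ ht, returnRate]
  have : μ / ℓ * (t - a * ℓ) = μ * (t / ℓ - a) := by field_simp
  rw [this]
  field_simp

theorem returnRate_pos (ha : 0 < a) (hμ : 0 < μ) {y : ℝ} (hy : a < y) :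
    0 < returnRate a μ α y := by
  have hy' : 0 < y - a := sub_pos.2 hy
  have : 0 < (μ * (y - a)) ^ α := by positivity
  refine div_pos (sub_pos.2 (Real.exp_lt_one_iff.2 (neg_lt_zero.2 this))) (ha.trans hy)

theorem load_mul_shiftedWeibull_Iic_lt (ha : 0 < a) (hμ : 0 < μ) (hα : 0 < α) {lam : ℝ}
    (hlam : IsHCMMRate a μ α lam) (ht : 0 < t) (hℓ : 0 ≤ ℓ) (hne : ℓ ≠ t / lam) :
    ℓ * (shiftedWeibull a μ α ℓ).real (Set.Iic t) < t * returnRate a μ α lam := by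
  have hpos : 0 < t * returnRate a μ α lam := mul_pos ht (returnRate_pos ha hμ hlam.1)
  rcases hℓ.eq_or_lt with rfl | hℓ
  · simpa using hpos
  rcases le_or_gt t (a * ℓ) with h | h
  · simpa [shiftedWeibull_Iic_of_le hμ hα hℓ h] using hpos
  · rw [load_mul_shiftedWeibull_Iic hμ hα hℓ ht h.le]
    refine mul_lt_mul_of_pos_left (returnRate_lt ha hμ hα hlam ((lt_div_iff₀ hℓ).2 h) ?_) ht
    rintro rfl
    exact hne (by field_simp)

theorem load_mul_shiftedWeibull_Iic_eq (ha : 0 < a) (hμ : 0 < μ) (hα : 0 < α) {lam : ℝ}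
    (hlam : IsHCMMRate a μ α lam) (ht : 0 < t) :
    t / lam * (shiftedWeibull a μ α (t / lam)).real (Set.Iic t) = t * returnRate a μ α lam := by
  have hl : 0 < lam := ha.trans hlam.1
  rw [load_mul_shiftedWeibull_Iic hμ hα (by positivity) ht]
  · congr 2
    field_simp
  · rw [← mul_div_assoc, div_le_iff₀ hl]
    nlinarith [hlam.1]

theorem load_mul_shiftedWeibull_Iic_le (ha : 0 < a) (hμ : 0 < μ) (hα : 0 < α) {lam : ℝ}
    (hlam : IsHCMMRate a μ α lam) (ht : 0 < t) (hℓ : 0 ≤ ℓ) :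
    ℓ * (shiftedWeibull a μ α ℓ).real (Set.Iic t) ≤ t * returnRate a μ α lam := by
  rcases eq_or_ne ℓ (t / lam) with rfl | h
  · exact (load_mul_shiftedWeibull_Iic_eq ha hμ hα hlam ht).le
  · exact (load_mul_shiftedWeibull_Iic_lt ha hμ hα hlam ht hℓ h).le

end ShiftedWeibull

/-! ### Maximizing the expected aggregate return, worker by worker -/

section ExpectedReturn

variable {n : ℕ} {a μ α ℓ : Fin n → ℝ} {t : ℝ}

instance : IsProbabilityMeasure (runTimeLaw a μ α ℓ) := by
  unfold runTimeLaw; infer_instance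

theorem integral_workerReturn (i : Fin n) :
    ∫ T, (if T i ≤ t then ℓ i else 0) ∂(runTimeLaw a μ α ℓ) =
      ℓ i * (shiftedWeibull (a i) (μ i) (α i) (ℓ i)).real (Set.Iic t) := by
  have h := integral_comp_eval (μ := fun i => shiftedWeibull (a i) (μ i) (α i) (ℓ i)) (i := i)
    (f := fun x : ℝ => if x ≤ t then ℓ i else 0)
    (Measurable.ite measurableSet_Iic measurable_const measurable_const).aestronglyMeasurable
  rw [runTimeLaw, h]
  have : (fun x : ℝ => if x ≤ t then ℓ i else 0) = (Set.Iic t).indicator fun _ => ℓ i := by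
    ext x; simp [Set.indicator]
  rw [this, integral_indicator_const _ measurableSet_Iic, smul_eq_mul, mul_comm]

theorem measurable_workerReturn (i : Fin n) :
    Measurable fun T : Fin n → ℝ => if T i ≤ t then ℓ i else 0 :=
  Measurable.ite (measurableSet_le (measurable_pi_apply i) measurable_const) measurable_const
    measurable_const

theorem measurable_aggregateReturn : Measurable fun T : Fin n → ℝ => aggregateReturn ℓ T t :=
  Finset.measurable_fun_sum _ fun i _ => measurable_workerReturn i

theorem integrable_workerReturn (i : Fin n) :
    Integrable (fun T : Fin n → ℝ => if T i ≤ t then ℓ i else 0) (runTimeLaw a μ α ℓ) := by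
  refine Integrable.of_bound (measurable_workerReturn i).aestronglyMeasurable |ℓ i| ?_
  filter_upwards with T
  split_ifs <;> simp

theorem expectedReturn_eq_sum : expectedReturn a μ α ℓ t =
    ∑ i, ℓ i * (shiftedWeibull (a i) (μ i) (α i) (ℓ i)).real (Set.Iic t) := by
  unfold expectedReturn aggregateReturn
  rw [integral_finsetSum _ fun i _ => integrable_workerReturn i]
  exact Finset.sum_congr rfl fun i _ => integral_workerReturn i

theorem isReturnMaximizer_iff {lam : Fin n → ℝ} (ha : ∀ i, 0 < a i) (hμ : ∀ i, 0 < μ i)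
    (hα : ∀ i, 0 < α i) (hlam : ∀ i, IsHCMMRate (a i) (μ i) (α i) (lam i)) (ht : 0 < t) :
    IsReturnMaximizer a μ α t ℓ ↔ ℓ = fun i => t / lam i := by
  have hnn : ∀ i, 0 ≤ t / lam i := fun i => (div_pos ht ((ha i).trans (hlam i).1)).le
  have hbest : expectedReturn a μ α (fun i => t / lam i) t =
      ∑ i, t * returnRate (a i) (μ i) (α i) (lam i) := by
    rw [expectedReturn_eq_sum]
    exact Finset.sum_congr rfl fun i _ =>
      load_mul_shiftedWeibull_Iic_eq (ha i) (hμ i) (hα i) (hlam i) ht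
  constructor
  · rintro ⟨h0, h⟩
    by_contra hne
    obtain ⟨i, hi⟩ := Function.ne_iff.1 hne
    refine (h _ hnn).not_gt ?_
    rw [hbest, expectedReturn_eq_sum]
    exact Finset.sum_lt_sum
      (fun i _ => load_mul_shiftedWeibull_Iic_le (ha i) (hμ i) (hα i) (hlam i) ht (h0 i))
      ⟨i, Finset.mem_univ i,
        load_mul_shiftedWeibull_Iic_lt (ha i) (hμ i) (hα i) (hlam i) ht (h0 i) hi⟩
  · rintro rfl
    refine ⟨hnn, fun ℓ' h' => ?_⟩
    rw [hbest, expectedReturn_eq_sum]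
    exact Finset.sum_le_sum
      (fun i _ => load_mul_shiftedWeibull_Iic_le (ha i) (hμ i) (hα i) (hlam i) ht (h' i))

end ExpectedReturn

/-! ### Measurability and truncation of the completion time -/

section CompletionTime

variable {n : ℕ} {ℓ T : Fin n → ℝ} {r : ℕ}

theorem aggregateReturn_mono (hℓ : ∀ i, 0 ≤ ℓ i) : Monotone (aggregateReturn ℓ T) := by
  intro s t hst
  refine Finset.sum_le_sum fun i _ => ?_
  split_ifs with h1 h2
  · exact le_rfl
  · exact absurd (h1.trans hst) h2
  · exact hℓ i
  · exact le_rfl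

theorem completionTime_le {t : ℝ} (ht : 0 ≤ t) (h : (r : ℝ) ≤ aggregateReturn ℓ T t) :
    completionTime r ℓ T ≤ ENNReal.ofReal t :=
  iInf₂_le (⟨t, ht⟩ : ℝ≥0) h |>.trans_eq (ENNReal.ofReal_eq_coe_nnreal ht).symm

/-- The return is nondecreasing in time and the inequality is strict, so rational times suffice;
sublevel sets become countable unions. -/
theorem completionTime_lt_iff (hℓ : ∀ i, 0 ≤ ℓ i) {c : ℝ≥0∞} :
    completionTime r ℓ T < c ↔ ∃ q : ℚ≥0, ((q : ℝ≥0) : ℝ≥0∞) < c ∧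
      (r : ℝ) ≤ aggregateReturn ℓ T ((q : ℝ≥0) : ℝ) := by
  simp only [completionTime, iInf_lt_iff]
  constructor
  · rintro ⟨t, ht, htc⟩
    obtain ⟨s, hts, hsc⟩ := ENNReal.lt_iff_exists_nnreal_btwn.1 htc
    obtain ⟨q, h1, h2⟩ := exists_rat_btwn (NNReal.coe_lt_coe.2 (ENNReal.coe_lt_coe.1 hts))
    lift q to ℚ≥0 using by exact_mod_cast t.coe_nonneg.trans h1.le
    replace h2 : (q : ℝ≥0) < s := by exact_mod_cast h2
    refine ⟨q, (ENNReal.coe_lt_coe.2 h2).trans hsc, ht.trans (aggregateReturn_mono hℓ ?_)⟩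
    exact_mod_cast h1.le
  · rintro ⟨q, hq, h⟩
    exact ⟨q, h, hq⟩

theorem le_aggregateReturn_of_completionTime_lt (hℓ : ∀ i, 0 ≤ ℓ i) {t : ℝ≥0}
    (h : completionTime r ℓ T < t) : (r : ℝ) ≤ aggregateReturn ℓ T t := by
  obtain ⟨q, hq, hr⟩ := (completionTime_lt_iff hℓ).1 h
  exact hr.trans (aggregateReturn_mono hℓ (ENNReal.coe_lt_coe.1 hq).le)

theorem measurable_completionTime (hℓ : ∀ i, 0 ≤ ℓ i) :
    Measurable fun T : Fin n → ℝ => completionTime r ℓ T := by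
  refine measurable_of_Iio fun c => ?_
  have : (fun T : Fin n → ℝ => completionTime r ℓ T) ⁻¹' Set.Iio c =
      ⋃ (q : ℚ≥0) (_ : ((q : ℝ≥0) : ℝ≥0∞) < c),
        {T | (r : ℝ) ≤ aggregateReturn ℓ T ((q : ℝ≥0) : ℝ)} := by
    ext T
    simp [completionTime_lt_iff hℓ]
  rw [this]
  exact MeasurableSet.iUnion fun q => MeasurableSet.iUnion fun _ =>
    measurableSet_le measurable_const measurable_aggregateReturn

/-- Reducing all loads to at most `r` does not delay the completion. -/
theorem completionTime_min_le {T' : Fin n → ℝ} (hℓ : ∀ i, 0 ≤ ℓ i) (hT : ∀ i, T' i ≤ T i) :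
    completionTime r (fun i => min (ℓ i) r) T' ≤ completionTime r ℓ T := by
  have hnn : ∀ i, 0 ≤ min (ℓ i) (r : ℝ) := fun i => le_min (hℓ i) r.cast_nonneg
  refine le_iInf₂ fun t ht => iInf₂_le t ?_
  -- A finished worker with load at least `r` completes the job alone, even after truncation;
  -- otherwise truncation changes no finished load.
  by_cases h : ∃ i, T i ≤ t ∧ (r : ℝ) ≤ ℓ i
  · obtain ⟨i, hi, hri⟩ := h
    calc (r : ℝ) = if T' i ≤ t then min (ℓ i) r else 0 := by
          rw [if_pos ((hT i).trans hi), min_eq_right hri]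
      _ ≤ _ := Finset.single_le_sum (f := fun i => if T' i ≤ t then min (ℓ i) (r : ℝ) else 0)
          (fun j _ => by split_ifs <;> simp [hnn]) (Finset.mem_univ i)
  · push Not at h
    refine ht.trans (Finset.sum_le_sum fun i _ => ?_)
    split_ifs with h1 h2 h2
    · exact le_min le_rfl (h i h1).le
    · exact absurd ((hT i).trans h1) h2
    · exact hnn i
    · exact le_rfl

end CompletionTime

/-! ### Existence of an optimal allocation -/

section OptimalAllocation

variable {n : ℕ} {a μ α ℓ : Fin n → ℝ} {r : ℕ}

/-- The run-times as functions of the loads and of independent standard exponential variables. -/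
noncomputable def coupledRunTime (a μ α ℓ x : Fin n → ℝ) : Fin n → ℝ :=
  fun i => a i * ℓ i + ℓ i / μ i * x i ^ (1 / α i)

theorem measurable_coupledRunTime : Measurable (coupledRunTime a μ α ℓ) :=
  measurable_pi_lambda _ fun i =>
    (measurable_shiftedWeibull_map (a i) (μ i) (α i) (ℓ i)).comp (measurable_pi_apply i)

instance : IsProbabilityMeasure (expMeasure 1) := isProbabilityMeasure_expMeasure one_pos

theorem map_coupledRunTime :
    (Measure.pi fun _ => expMeasure 1).map (coupledRunTime a μ α ℓ) = runTimeLaw a μ α ℓ := by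
  have : ∀ i, IsProbabilityMeasure ((expMeasure 1).map
      fun x => a i * ℓ i + ℓ i / μ i * x ^ (1 / α i)) := fun i =>
    Measure.isProbabilityMeasure_map (measurable_shiftedWeibull_map _ _ _ _).aemeasurable
  exact Measure.pi_map_pi fun i => (measurable_shiftedWeibull_map _ _ _ _).aemeasurable

/-- All allocations now live on one probability space, so they can be compared, and limits taken,
pointwise. -/
theorem expectedCompletionTime_eq_lintegral (hℓ : ∀ i, 0 ≤ ℓ i) :
    expectedCompletionTime a μ α r ℓ =
      ∫⁻ x, completionTime r ℓ (coupledRunTime a μ α ℓ x) ∂(Measure.pi fun _ => expMeasure 1) := by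
  rw [expectedCompletionTime, ← map_coupledRunTime,
    lintegral_map (measurable_completionTime hℓ) measurable_coupledRunTime]

theorem expectedCompletionTime_min_le (ha : ∀ i, 0 < a i) (hμ : ∀ i, 0 < μ i)
    (hℓ : ∀ i, 0 ≤ ℓ i) :
    expectedCompletionTime a μ α r (fun i => min (ℓ i) r) ≤ expectedCompletionTime a μ α r ℓ := by
  rw [expectedCompletionTime_eq_lintegral hℓ,
    expectedCompletionTime_eq_lintegral fun i => le_min (hℓ i) r.cast_nonneg]
  have hpos : ∀ᵐ x ∂(Measure.pi fun _ : Fin n => expMeasure 1), ∀ i, 0 < x i :=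
    ae_all_iff.2 fun i =>
      (Measure.quasiMeasurePreserving_eval (fun _ : Fin n => expMeasure 1) i).ae
        ae_expMeasure_one_pos
  refine lintegral_mono_ae ?_
  filter_upwards [hpos] with x hx
  refine completionTime_min_le hℓ fun i => ?_
  have h1 : min (ℓ i) (r : ℝ) ≤ ℓ i := min_le_left _ _
  have h2 : 0 ≤ x i ^ (1 / α i) := Real.rpow_nonneg (hx i).le _
  have := ha i
  have := hμ i
  unfold coupledRunTime
  gcongr

/-- Run-times are continuous in the loads and finishing by time `c` is a closed condition, so the
return at `c` is upper semicontinuous and reaching `r` by `c` survives limits. -/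
theorem lowerSemicontinuousOn_completionTime (x : Fin n → ℝ) :
    LowerSemicontinuousOn (fun ℓ => completionTime r ℓ (coupledRunTime a μ α ℓ x))
      (Set.Icc 0 fun _ => (r : ℝ)) := by
  rw [lowerSemicontinuousOn_iff_frequently]
  intro ℓ hℓ y hy
  by_contra! h
  obtain ⟨c, hyc, hc⟩ := ENNReal.lt_iff_exists_nnreal_btwn.1 h
  refine hc.not_ge ?_
  rw [← ENNReal.ofReal_coe_nnreal]
  refine completionTime_le c.coe_nonneg ?_
  have hfreq : ∃ᶠ ℓ' in 𝓝[Set.Icc 0 fun _ => (r : ℝ)] ℓ,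
      (r : ℝ) ≤ aggregateReturn ℓ' (coupledRunTime a μ α ℓ' x) c :=
    (hy.and_eventually self_mem_nhdsWithin).mono fun ℓ' h' =>
      le_aggregateReturn_of_completionTime_lt h'.2.1 (h'.1.trans_lt hyc)
  have hcoord : ∀ i, Continuous fun ℓ' : Fin n → ℝ => coupledRunTime a μ α ℓ' x i := by
    intro i
    unfold coupledRunTime
    fun_prop
  have hev : ∀ ε > 0, ∀ i, ∀ᶠ ℓ' : Fin n → ℝ in 𝓝 ℓ,
      (if coupledRunTime a μ α ℓ' x i ≤ c then ℓ' i else 0) ≤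
        (if coupledRunTime a μ α ℓ x i ≤ c then ℓ i else 0) + ε := by
    intro ε hε i
    by_cases hi : coupledRunTime a μ α ℓ x i ≤ c
    · filter_upwards [(continuous_apply i).continuousAt.eventually_lt_const
        (lt_add_of_pos_right (ℓ i) hε)] with ℓ' h1
      rw [if_pos hi]
      have := hℓ.1 i
      simp only [Pi.zero_apply] at this
      split_ifs
      · exact h1.le
      · positivity
    · filter_upwards [(hcoord i).continuousAt.eventually_const_lt (not_le.1 hi)] with ℓ' h1
      rw [if_neg hi, if_neg h1.not_ge]
      linarith
  refine le_of_forall_pos_le_add fun ε hε => ?_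
  -- The denominator `n + 1` also covers an empty cluster.
  obtain ⟨ℓ', h1, h2⟩ := (hfreq.and_eventually (nhdsWithin_le_nhds
    (eventually_all.2 (hev (ε / (n + 1)) (by positivity))))).exists
  calc (r : ℝ) ≤ _ := h1
    _ ≤ ∑ i, ((if coupledRunTime a μ α ℓ x i ≤ c then ℓ i else 0) + ε / (n + 1)) :=
        Finset.sum_le_sum fun i _ => h2 i
    _ = aggregateReturn ℓ (coupledRunTime a μ α ℓ x) c + n * (ε / (n + 1)) := by
        simp [Finset.sum_add_distrib, aggregateReturn]
    _ ≤ _ := by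
        gcongr
        rw [← mul_div_assoc, div_le_iff₀ (by positivity)]
        nlinarith

theorem lowerSemicontinuousOn_expectedCompletionTime :
    LowerSemicontinuousOn (expectedCompletionTime a μ α r) (Set.Icc 0 fun _ => (r : ℝ)) := by
  intro ℓ hℓ y hy
  suffices h : expectedCompletionTime a μ α r ℓ ≤
      liminf (expectedCompletionTime a μ α r) (𝓝[Set.Icc 0 fun _ => (r : ℝ)] ℓ) from
    eventually_lt_of_lt_liminf (hy.trans_le h)
  calc expectedCompletionTime a μ α r ℓ
      = ∫⁻ x, completionTime r ℓ (coupledRunTime a μ α ℓ x)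
          ∂(Measure.pi fun _ => expMeasure 1) := expectedCompletionTime_eq_lintegral hℓ.1
    -- Fatou's lemma asks for measurability at every `ℓ'`, which is known for nonnegative loads; `ℓ'
    -- ⊔ 0` agrees with `ℓ'` on the box.
    _ ≤ ∫⁻ x, liminf (fun ℓ' => completionTime r (ℓ' ⊔ 0) (coupledRunTime a μ α (ℓ' ⊔ 0) x))
          (𝓝[Set.Icc 0 fun _ => (r : ℝ)] ℓ) ∂(Measure.pi fun _ => expMeasure 1) := by
        refine lintegral_mono fun x => le_of_forall_lt_imp_le_of_dense fun y hy => ?_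
        refine le_liminf_of_le (by isBoundedDefault) ?_
        filter_upwards [self_mem_nhdsWithin, lowerSemicontinuousOn_completionTime x ℓ hℓ y hy]
          with ℓ' h1 h2
        rw [sup_eq_left.2 h1.1]
        exact h2.le
    _ ≤ liminf (fun ℓ' => ∫⁻ x, completionTime r (ℓ' ⊔ 0) (coupledRunTime a μ α (ℓ' ⊔ 0) x)
          ∂(Measure.pi fun _ => expMeasure 1)) (𝓝[Set.Icc 0 fun _ => (r : ℝ)] ℓ) :=
        lintegral_liminf_le fun ℓ' =>
          (measurable_completionTime fun i => le_sup_right).comp measurable_coupledRunTime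
    _ = _ := by
        refine liminf_congr ?_
        filter_upwards [self_mem_nhdsWithin] with ℓ' h1
        rw [sup_eq_left.2 h1.1, expectedCompletionTime_eq_lintegral h1.1]

theorem exists_isOptimalAllocation (ha : ∀ i, 0 < a i) (hμ : ∀ i, 0 < μ i) :
    ∃ ℓ, IsOptimalAllocation a μ α r ℓ := by
  have hne : (Set.Icc (0 : Fin n → ℝ) fun _ => (r : ℝ)).Nonempty :=
    ⟨0, le_rfl, fun _ => r.cast_nonneg⟩
  obtain ⟨ℓ, hℓ, hmin⟩ := LowerSemicontinuousOn.exists_isMinOn hne isCompact_Icc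
    (lowerSemicontinuousOn_expectedCompletionTime (a := a) (μ := μ) (α := α))
  refine ⟨ℓ, hℓ.1, fun ℓ' h' => ?_⟩
  refine le_trans ?_ (expectedCompletionTime_min_le ha hμ h')
  exact hmin ⟨fun i => le_min (h' i) r.cast_nonneg, fun i => min_le_right _ _⟩

end OptimalAllocation

/-! ### Hoeffding bounds uniform in the loads -/

section Concentration

variable {n : ℕ} {a μ α ℓ : Fin n → ℝ} {t K : ℝ}

theorem ae_runTimeLaw_eval {i : Fin n} {p : ℝ → Prop}
    (h : ∀ᵐ x ∂(shiftedWeibull (a i) (μ i) (α i) (ℓ i)), p x) :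
    ∀ᵐ T ∂(runTimeLaw a μ α ℓ), p (T i) :=
  (Measure.quasiMeasurePreserving_eval
    (fun i => shiftedWeibull (a i) (μ i) (α i) (ℓ i)) i).ae h

/-- A worker needs at least time `a i * ℓ i`, so one that finishes by `t` returns at most `t / a i ≤
K`, however large other loads may be. -/
theorem hasSubgaussianMGF_workerReturn (ha : ∀ i, 0 < a i) (hμ : ∀ i, 0 < μ i)
    (hℓ : ∀ i, 0 ≤ ℓ i) (hK : 0 ≤ K) (htK : ∀ i, t ≤ K * a i) (i : Fin n) :
    HasSubgaussianMGF (fun T : Fin n → ℝ => (if T i ≤ t then ℓ i else 0) -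
      ∫ T, (if T i ≤ t then ℓ i else 0) ∂(runTimeLaw a μ α ℓ)) ((‖K - 0‖₊ / 2) ^ 2)
      (runTimeLaw a μ α ℓ) := by
  refine hasSubgaussianMGF_of_mem_Icc (measurable_workerReturn i).aemeasurable ?_
  filter_upwards [ae_runTimeLaw_eval (ae_shiftedWeibull_ge (a := a i) (α := α i) (hμ i) (hℓ i))]
    with T hT
  split_ifs with h
  · refine ⟨hℓ i, ?_⟩
    have h1 : a i * ℓ i ≤ a i * K := by linarith [htK i]
    exact le_of_mul_le_mul_left h1 (ha i)
  · exact ⟨le_rfl, hK⟩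

theorem iIndepFun_workerReturn :
    iIndepFun (fun i (T : Fin n → ℝ) => (if T i ≤ t then ℓ i else 0) -
      ∫ T, (if T i ≤ t then ℓ i else 0) ∂(runTimeLaw a μ α ℓ)) (runTimeLaw a μ α ℓ) :=
  iIndepFun_pi (X := fun i x => (if x ≤ t then ℓ i else 0) -
      ∫ T, (if T i ≤ t then ℓ i else 0) ∂(runTimeLaw a μ α ℓ)) fun _ =>
    ((Measurable.ite measurableSet_Iic measurable_const measurable_const).sub_const _).aemeasurable

theorem sum_workerReturn_sub_integral (T : Fin n → ℝ) :
    ∑ i, ((if T i ≤ t then ℓ i else 0) -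
      ∫ T, (if T i ≤ t then ℓ i else 0) ∂(runTimeLaw a μ α ℓ)) =
      aggregateReturn ℓ T t - expectedReturn a μ α ℓ t := by
  rw [Finset.sum_sub_distrib, expectedReturn_eq_sum]
  simp_rw [integral_workerReturn]
  rfl

theorem exp_hoeffding_eq (x : ℝ) :
    Real.exp (-x ^ 2 / (2 * ((∑ _i : Fin n, (‖K - 0‖₊ / 2) ^ 2 : ℝ≥0) : ℝ))) =
      Real.exp (-(2 * x ^ 2) / (n * K ^ 2)) := by
  congr 1
  have : 2 * ((∑ _i : Fin n, (‖K - 0‖₊ / 2) ^ 2 : ℝ≥0) : ℝ) = n * K ^ 2 / 2 := by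
    simp only [sub_zero, Finset.sum_const, Finset.card_univ, Fintype.card_fin, nsmul_eq_mul]
    push_cast
    rw [Real.norm_eq_abs, div_pow, sq_abs]
    ring
  rw [this, div_div_eq_mul_div]
  ring

theorem measureReal_aggregateReturn_ge_le (ha : ∀ i, 0 < a i) (hμ : ∀ i, 0 < μ i)
    (hℓ : ∀ i, 0 ≤ ℓ i) (hK : 0 ≤ K) (htK : ∀ i, t ≤ K * a i) {x : ℝ} (hx : 0 ≤ x) :
    (runTimeLaw a μ α ℓ).real {T | expectedReturn a μ α ℓ t + x ≤ aggregateReturn ℓ T t} ≤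
      Real.exp (-(2 * x ^ 2) / (n * K ^ 2)) := by
  have h := HasSubgaussianMGF.measure_sum_ge_le_of_iIndepFun
    (iIndepFun_workerReturn (a := a) (μ := μ) (α := α) (ℓ := ℓ) (t := t)) (s := Finset.univ)
    (fun i _ => hasSubgaussianMGF_workerReturn ha hμ hℓ hK htK i) hx
  simp_rw [sum_workerReturn_sub_integral] at h
  push_cast at h
  rw [← exp_hoeffding_eq]
  push_cast
  convert h using 4
  constructor <;> intro h <;> linarith

theorem measureReal_aggregateReturn_le_le (ha : ∀ i, 0 < a i) (hμ : ∀ i, 0 < μ i)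
    (hℓ : ∀ i, 0 ≤ ℓ i) (hK : 0 ≤ K) (htK : ∀ i, t ≤ K * a i) {x : ℝ} (hx : 0 ≤ x) :
    (runTimeLaw a μ α ℓ).real {T | aggregateReturn ℓ T t ≤ expectedReturn a μ α ℓ t - x} ≤
      Real.exp (-(2 * x ^ 2) / (n * K ^ 2)) := by
  have hind := (iIndepFun_workerReturn (a := a) (μ := μ) (α := α) (ℓ := ℓ) (t := t)).comp
    (fun _ y => -y) fun _ => measurable_neg
  have h := HasSubgaussianMGF.measure_sum_ge_le_of_iIndepFun hind (s := Finset.univ)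
    (fun i _ => (hasSubgaussianMGF_workerReturn ha hμ hℓ hK htK i).neg) hx
  simp only [Function.comp_apply, Finset.sum_neg_distrib, sum_workerReturn_sub_integral] at h
  push_cast at h
  rw [← exp_hoeffding_eq]
  push_cast
  convert h using 4
  constructor <;> intro h <;> linarith

end Concentration

/-! ### Expected completion time in terms of the shortfall probability -/

section CompletionTimeBounds

variable {n : ℕ} {a μ α ℓ : Fin n → ℝ} {t : ℝ} {r : ℕ}

/-- Markov's inequality: after a shortfall at time `t` the completion time is at least `t`. -/
theorem ofReal_mul_le_expectedCompletionTime (hℓ : ∀ i, 0 ≤ ℓ i) :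
    ENNReal.ofReal t * runTimeLaw a μ α ℓ {T | aggregateReturn ℓ T t < r} ≤
      expectedCompletionTime a μ α r ℓ := by
  have hm : MeasurableSet {T : Fin n → ℝ | aggregateReturn ℓ T t < r} :=
    measurableSet_lt measurable_aggregateReturn measurable_const
  rw [expectedCompletionTime, ← lintegral_indicator_const hm]
  refine lintegral_mono fun T => Set.indicator_le (fun T hT => ?_) T
  by_contra! h
  have := le_aggregateReturn_of_completionTime_lt hℓ h
  rcases le_total 0 t with h0 | h0
  · rw [Real.coe_toNNReal t h0] at this
    exact this.not_gt hT
  · rw [ENNReal.ofReal_of_nonpos h0] at h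
    exact not_lt_zero h

theorem indepFun_sum_erase (i : Fin n) :
    IndepFun (fun T : Fin n → ℝ => ∑ j ∈ Finset.univ.erase i, if T j ≤ t then ℓ j else 0)
      (fun T => T i) (runTimeLaw a μ α ℓ) := by
  -- Coordinate `i` keeps its run-time and the others pass to their returns, so one independent
  -- family contains both sides.
  set f : Fin n → ℝ → ℝ := fun j => if j = i then id else fun x => if x ≤ t then ℓ j else 0
    with hf
  have hfm : ∀ j, Measurable (f j) := by
    intro j
    rw [hf]
    dsimp only
    split_ifs
    · exact measurable_id
    · exact Measurable.ite measurableSet_Iic measurable_const measurable_const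
  have hind : iIndepFun (fun j (T : Fin n → ℝ) => f j (T j)) (runTimeLaw a μ α ℓ) :=
    iIndepFun_pi fun j => (hfm j).aemeasurable
  have h := hind.indepFun_finsetSum_of_notMem
    (fun j => (hfm j).comp (measurable_pi_apply j)) (Finset.notMem_erase i Finset.univ)
  convert h using 1
  · ext T
    rw [Finset.sum_apply]
    refine Finset.sum_congr rfl fun j hj => ?_
    simp [hf, Finset.ne_of_mem_erase hj]
  · ext T
    simp [hf]

/-- The completion time exceeds `t` by at most the run-times of the workers on the event that the
return is too small at time `t`; each of these run-times is independent of the returns of the other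
workers. -/
theorem expectedCompletionTime_le (ha : ∀ i, 0 < a i) (hμ : ∀ i, 0 < μ i) (hℓ : ∀ i, 0 ≤ ℓ i)
    (ht : 0 ≤ t) (hr : (r : ℝ) ≤ ∑ i, ℓ i) {q M : ℝ≥0∞} (hq : q ≠ 0)
    (hqi : ∀ i, q ≤ shiftedWeibull (a i) (μ i) (α i) (ℓ i) (Set.Ioi t))
    (hM : ∀ i, ∫⁻ x, ENNReal.ofReal x ∂(shiftedWeibull (a i) (μ i) (α i) (ℓ i)) ≤ M) :
    expectedCompletionTime a μ α r ℓ ≤ ENNReal.ofReal t +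
      n * (runTimeLaw a μ α ℓ {T | aggregateReturn ℓ T t < r} / q * M) := by
  set P := runTimeLaw a μ α ℓ with hP
  set B : Set (Fin n → ℝ) := {T | aggregateReturn ℓ T t < r} with hB
  have hBm : MeasurableSet B := measurableSet_lt measurable_aggregateReturn measurable_const
  have hfm : ∀ i : Fin n, Measurable fun T : Fin n → ℝ => ENNReal.ofReal (T i) := fun i =>
    (measurable_pi_apply i).ennreal_ofReal
  have hpt : ∀ᵐ T ∂P, completionTime r ℓ T ≤ ENNReal.ofReal t +
      ∑ i, B.indicator (fun T => ENNReal.ofReal (T i)) T := by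
    have hnn : ∀ᵐ T ∂P, ∀ i, 0 ≤ T i := by
      refine ae_all_iff.2 fun i => ?_
      filter_upwards [ae_runTimeLaw_eval
        (ae_shiftedWeibull_ge (a := a i) (α := α i) (hμ i) (hℓ i))] with T hT
      exact (mul_nonneg (ha i).le (hℓ i)).trans hT
    filter_upwards [hnn] with T hT
    by_cases hTB : T ∈ B
    · refine le_trans ?_ le_add_self
      -- By the sum of all run-times every worker has finished, and the total load covers `r`.
      have : completionTime r ℓ T ≤ ENNReal.ofReal (∑ i, T i) := by
        refine completionTime_le (Finset.sum_nonneg fun i _ => hT i) (hr.trans_eq ?_)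
        refine Finset.sum_congr rfl fun i _ => ?_
        rw [if_pos (Finset.single_le_sum (fun j _ => hT j) (Finset.mem_univ i))]
      refine this.trans_eq ?_
      rw [ENNReal.ofReal_sum_of_nonneg fun i _ => hT i]
      simp [hTB]
    · exact (completionTime_le ht (not_lt.1 hTB)).trans le_self_add
  have hterm : ∀ i, ∫⁻ T, B.indicator (fun T => ENNReal.ofReal (T i)) T ∂P ≤ P B / q * M := by
    intro i
    set Y : (Fin n → ℝ) → ℝ :=
      fun T => ∑ j ∈ Finset.univ.erase i, if T j ≤ t then ℓ j else 0 with hY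
    have hYm : Measurable Y := Finset.measurable_fun_sum _ fun j _ => measurable_workerReturn j
    have hYX : ∀ T, aggregateReturn ℓ T t = Y T + if T i ≤ t then ℓ i else 0 := fun T =>
      (Finset.sum_erase_add _ _ (Finset.mem_univ i)).symm
    have hind : IndepFun Y (fun T => T i) P := indepFun_sum_erase i
    have hlaw : ∀ f : ℝ → ℝ≥0∞, Measurable f → ∫⁻ T, f (T i) ∂P =
        ∫⁻ x, f x ∂(shiftedWeibull (a i) (μ i) (α i) (ℓ i)) := fun f hf =>
      (measurePreserving_eval (fun i => shiftedWeibull (a i) (μ i) (α i) (ℓ i)) i).lintegral_comp hf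
    -- If the others fall short and worker `i` is still running, then `B` occurs; these two events
    -- are independent and the second has probability at least `q`.
    have hYB : P (Y ⁻¹' Set.Iio r) ≤ P B / q := by
      rw [ENNReal.le_div_iff_mul_le (Or.inl hq) (Or.inr (measure_ne_top _ _))]
      calc P (Y ⁻¹' Set.Iio r) * q
          ≤ P (Y ⁻¹' Set.Iio r) * P ((fun T => T i) ⁻¹' Set.Ioi t) := by
            gcongr
            refine (hqi i).trans_eq ?_
            exact ((measurePreserving_eval (fun i => shiftedWeibull (a i) (μ i) (α i) (ℓ i))
              i).measure_preimage measurableSet_Ioi.nullMeasurableSet).symm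
        _ = P (Y ⁻¹' Set.Iio r ∩ (fun T => T i) ⁻¹' Set.Ioi t) :=
            (hind.measure_inter_preimage_eq_mul _ _ measurableSet_Iio measurableSet_Ioi).symm
        _ ≤ P B := by
            refine measure_mono fun T hT => ?_
            have h2 : ¬ T i ≤ t := not_le.2 hT.2
            change aggregateReturn ℓ T t < r
            rw [hYX, if_neg h2, add_zero]
            exact hT.1
    have hφ : Measurable ((Set.Iio (r : ℝ)).indicator (fun _ => (1 : ℝ≥0∞))) :=
      measurable_const.indicator measurableSet_Iio
    -- Dropping worker `i` enlarges `B` to an event independent of `T i`, so the integral factors.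
    calc ∫⁻ T, B.indicator (fun T => ENNReal.ofReal (T i)) T ∂P
        ≤ ∫⁻ T, (Set.Iio (r : ℝ)).indicator (fun _ => (1 : ℝ≥0∞)) (Y T) * ENNReal.ofReal (T i) ∂P := by
          refine lintegral_mono fun T => ?_
          by_cases hT : T ∈ B
          swap
          · rw [Set.indicator_of_notMem hT]
            exact zero_le
          rw [Set.indicator_of_mem hT]
          have : Y T < r := by
            refine lt_of_le_of_lt ?_ hT
            rw [hYX]
            split_ifs <;> simp [hℓ i]
          rw [Set.indicator_of_mem (show Y T ∈ Set.Iio (r : ℝ) from this), one_mul]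
      _ = (∫⁻ T, (Set.Iio (r : ℝ)).indicator (fun _ => (1 : ℝ≥0∞)) (Y T) ∂P) *
            ∫⁻ T, ENNReal.ofReal (T i) ∂P :=
          lintegral_mul_eq_lintegral_mul_lintegral_of_indepFun (hφ.comp hYm) (hfm i)
            (hind.comp hφ ENNReal.measurable_ofReal)
      _ = P (Y ⁻¹' Set.Iio r) *
            ∫⁻ x, ENNReal.ofReal x ∂(shiftedWeibull (a i) (μ i) (α i) (ℓ i)) := by
          rw [hlaw _ ENNReal.measurable_ofReal]
          congr 1
          exact lintegral_indicator_one (hYm measurableSet_Iio)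
      _ ≤ P B / q * M := mul_le_mul' hYB (hM i)
  calc expectedCompletionTime a μ α r ℓ
      ≤ ∫⁻ T, (ENNReal.ofReal t + ∑ i, B.indicator (fun T => ENNReal.ofReal (T i)) T) ∂P :=
        lintegral_mono_ae hpt
    _ = ENNReal.ofReal t + ∑ i, ∫⁻ T, B.indicator (fun T => ENNReal.ofReal (T i)) T ∂P := by
        rw [lintegral_add_left measurable_const, lintegral_const, measure_univ, mul_one,
          lintegral_finsetSum _ fun i _ => (hfm i).indicator hBm]
    _ ≤ _ := by
        gcongr
        refine (Finset.sum_le_card_nsmul _ _ _ fun i _ => hterm i).trans_eq ?_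
        simp

end CompletionTimeBounds

/-! ### Moments of the run-times -/

section Moments

theorem lintegral_rpow_expMeasure_ne_top {p : ℝ} (hp : 0 < p) :
    ∫⁻ x, ENNReal.ofReal (x ^ p) ∂(expMeasure 1) ≠ ∞ := by
  have h1 : expMeasure 1 = volume.withDensity (exponentialPDF 1) := rfl
  have h2 : Measurable (exponentialPDF 1) := (measurable_exponentialPDFReal 1).ennreal_ofReal
  have h3 := (Real.GammaIntegral_convergent (s := p + 1) (by linarith)).lintegral_lt_top
  rw [h1, lintegral_withDensity_eq_lintegral_mul _ h2
    (show Measurable fun x : ℝ => ENNReal.ofReal (x ^ p) by fun_prop)]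
  refine ne_top_of_le_ne_top h3.ne ?_
  rw [← lintegral_indicator measurableSet_Ioi]
  refine lintegral_mono fun x => ?_
  simp only [Pi.mul_apply]
  rcases le_or_gt x 0 with hx | hx
  · rcases hx.eq_or_lt with rfl | hx
    · simp [hp.ne']
    · simp [exponentialPDF_of_neg hx]
  · rw [Set.indicator_of_mem (Set.mem_Ioi.2 hx), exponentialPDF_of_nonneg hx.le,
      ← ENNReal.ofReal_mul (by positivity)]
    simp

/-- For positive x, x^(1/α) ≤ 1 + x^(1/c) whenever α ≥ c, so one moment serves all shape parameters.
-/
theorem lintegral_shiftedWeibull_le {a μ α ℓ c : ℝ} (ha : 0 < a) (hμ : 0 < μ) (hc : 0 < c)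
    (hcα : c ≤ α) (hℓ : 0 ≤ ℓ) :
    ∫⁻ x, ENNReal.ofReal x ∂(shiftedWeibull a μ α ℓ) ≤ ENNReal.ofReal (a * ℓ) +
      ENNReal.ofReal (ℓ / μ) * (1 + ∫⁻ x, ENNReal.ofReal (x ^ (1 / c)) ∂(expMeasure 1)) := by
  rw [shiftedWeibull, lintegral_map ENNReal.measurable_ofReal
    (measurable_shiftedWeibull_map a μ α ℓ)]
  calc _ ≤ ∫⁻ x, (ENNReal.ofReal (a * ℓ) +
        ENNReal.ofReal (ℓ / μ) * (1 + ENNReal.ofReal (x ^ (1 / c)))) ∂(expMeasure 1) := by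
        refine lintegral_mono_ae ?_
        filter_upwards [ae_expMeasure_one_pos] with x hx
        have h0 : 0 ≤ x ^ (1 / c) := Real.rpow_nonneg hx.le _
        have h1 : x ^ (1 / α) ≤ 1 + x ^ (1 / c) := by
          rcases le_total x 1 with h | h
          · have := Real.rpow_le_one hx.le h (by have := hc.trans_le hcα; positivity : 0 ≤ 1 / α)
            linarith
          · have := Real.rpow_le_rpow_of_exponent_le h (one_div_le_one_div_of_le hc hcα)
            linarith
        rw [← ENNReal.ofReal_one, ← ENNReal.ofReal_add zero_le_one h0,
          ← ENNReal.ofReal_mul (by positivity), ← ENNReal.ofReal_add (by positivity)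
          (by positivity)]
        gcongr
    _ = _ := by
        have hm : Measurable fun x : ℝ => ENNReal.ofReal (x ^ (1 / c)) :=
          (measurable_id.pow_const _).ennreal_ofReal
        rw [lintegral_add_left measurable_const, lintegral_const_mul _ (hm.const_add 1),
          lintegral_add_left measurable_const]
        simp

end Moments

/-! ### Constants uniform over workers and clusters -/

section UniformBounds

theorem IsThetaOne.exists_common_bounds {a μ α : (n : ℕ) → Fin n → ℝ} (ha : IsThetaOne a)
    (hμ : IsThetaOne μ) (hα : IsThetaOne α) : ∃ c C : ℝ, 0 < c ∧ c ≤ C ∧ ∀ n i,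
      a n i ∈ Set.Icc c C ∧ μ n i ∈ Set.Icc c C ∧ α n i ∈ Set.Icc c C := by
  obtain ⟨c₁, C₁, h₁, H₁⟩ := ha
  obtain ⟨c₂, C₂, h₂, H₂⟩ := hμ
  obtain ⟨c₃, C₃, h₃, H₃⟩ := hα
  have key : ∀ n i, a n i ∈ Set.Icc (min c₁ (min c₂ c₃)) (max C₁ (max C₂ C₃)) ∧
      μ n i ∈ Set.Icc (min c₁ (min c₂ c₃)) (max C₁ (max C₂ C₃)) ∧
      α n i ∈ Set.Icc (min c₁ (min c₂ c₃)) (max C₁ (max C₂ C₃)) := fun n i => by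
    refine ⟨⟨?_, ?_⟩, ⟨?_, ?_⟩, ⟨?_, ?_⟩⟩ <;> simp [H₁ n i, H₂ n i, H₃ n i]
  -- The bounds are vacuous for `n = 0`; the comparison of the two constants is read off the
  -- one-worker cluster.
  exact ⟨_, _, by positivity, (key 1 0).1.1.trans (key 1 0).1.2, key⟩

variable {c C : ℝ}

/-- The maximal rate is at least the rate at `a + 1`, which is explicit. The base `min 1 c` is at
most 1, so `C` is the worst exponent. -/
theorem exists_forall_le_returnRate (hc : 0 < c) (hcC : c ≤ C) :
    ∃ g > 0, ∀ a ∈ Set.Icc c C, ∀ μ ∈ Set.Icc c C, ∀ α ∈ Set.Icc c C, ∀ lam,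
      IsHCMMRate a μ α lam → g ≤ returnRate a μ α lam := by
  have hC : 0 < C := hc.trans_le hcC
  have hm : 0 < min 1 c := lt_min one_pos hc
  refine ⟨(1 - Real.exp (-(min 1 c) ^ C)) / (C + 1), ?_, ?_⟩
  · have : 0 < min 1 c ^ C := Real.rpow_pos_of_pos hm C
    have := Real.exp_lt_one_iff.2 (neg_lt_zero.2 this)
    exact div_pos (by linarith) (by linarith)
  · intro a ha μ hμ α hα lam hlam
    have ha0 := hc.trans_le ha.1
    have hμ0 := hc.trans_le hμ.1
    have hα0 := hc.trans_le hα.1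
    have h1 : returnRate a μ α (a + 1) ≤ returnRate a μ α lam := by
      rcases eq_or_ne (a + 1) lam with h | h
      · rw [h]
      · exact (returnRate_lt ha0 hμ0 hα0 hlam (by linarith) h).le
    refine le_trans ?_ h1
    have h2 : min 1 c ^ C ≤ μ ^ α :=
      (Real.rpow_le_rpow_of_exponent_ge hm (min_le_left _ _) hα.2).trans
        (Real.rpow_le_rpow hm.le ((min_le_right _ _).trans hμ.1) hα0.le)
    have h3 : 0 < μ ^ α := by positivity
    have h4 := Real.exp_lt_one_iff.2 (neg_lt_zero.2 h3)
    rw [returnRate, add_sub_cancel_left, mul_one]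
    exact div_le_div₀ (by linarith) (by gcongr) (by linarith) (by linarith [ha.2])

theorem returnRate_le_one_div {a μ α lam : ℝ} (hlam : 0 < lam) :
    returnRate a μ α lam ≤ 1 / lam := by
  unfold returnRate
  gcongr
  linarith [Real.exp_pos (-(μ * (lam - a)) ^ α)]

/-- The survival probability is exp(-(μ(lam - a))^α), whatever `t` is, and `g ≤ 1 / lam` bounds
`lam`. The maximum with 1 permits raising the exponent to `C`. -/
theorem le_shiftedWeibull_Ioi (hc : 0 < c) {a μ α lam g t : ℝ} (ha : a ∈ Set.Icc c C)
    (hμ : μ ∈ Set.Icc c C) (hα : α ∈ Set.Icc c C) (hlam : IsHCMMRate a μ α lam) (hg : 0 < g)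
    (hgr : g ≤ returnRate a μ α lam) (ht : 0 < t) :
    ENNReal.ofReal (Real.exp (-(max 1 (C / g)) ^ C)) ≤
      shiftedWeibull a μ α (t / lam) (Set.Ioi t) := by
  have ha0 := hc.trans_le ha.1
  have hμ0 := hc.trans_le hμ.1
  have hα0 := hc.trans_le hα.1
  have hl0 : 0 < lam := ha0.trans hlam.1
  have hla : 0 < lam - a := sub_pos.2 hlam.1
  have hlg : lam ≤ 1 / g := by
    have := hgr.trans (returnRate_le_one_div hl0)
    rwa [le_div_iff₀ hl0, mul_comm, ← le_div_iff₀ hg] at this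
  have h1 : a * (t / lam) ≤ t := by
    rw [← mul_div_assoc, div_le_iff₀ hl0]
    nlinarith [hlam.1]
  have h2 := shiftedWeibull_Iic hμ0 hα0 (by positivity : 0 < t / lam) h1
  have h3 : μ / (t / lam) * (t - a * (t / lam)) = μ * (lam - a) := by field_simp
  rw [h3] at h2
  have h4 : (shiftedWeibull a μ α (t / lam)).real (Set.Ioi t) =
      Real.exp (-(μ * (lam - a)) ^ α) := by
    rw [← Set.compl_Iic, probReal_compl_eq_one_sub measurableSet_Iic, h2, sub_sub_cancel]
  rw [ENNReal.ofReal_le_iff_le_toReal (measure_ne_top _ _)]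
  change _ ≤ (shiftedWeibull a μ α (t / lam)).real (Set.Ioi t)
  rw [h4]
  have h5 : μ * (lam - a) ≤ max 1 (C / g) := by
    refine le_trans ?_ (le_max_right _ _)
    calc μ * (lam - a) ≤ C * (1 / g) :=
          mul_le_mul hμ.2 (by linarith) hla.le (hμ0.le.trans hμ.2)
      _ = C / g := by ring
  have h6 : (μ * (lam - a)) ^ α ≤ max 1 (C / g) ^ C :=
    (Real.rpow_le_rpow (by positivity) h5 hα0.le).trans
      (Real.rpow_le_rpow_of_exponent_le (le_max_left _ _) hα.2)
  gcongr

theorem lintegral_shiftedWeibull_div_le (hc : 0 < c) {a μ α lam t K : ℝ} (ha : a ∈ Set.Icc c C)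
    (hμ : μ ∈ Set.Icc c C) (hα : α ∈ Set.Icc c C) (hlam : IsHCMMRate a μ α lam)
    (ht : 0 < t) (htK : t ≤ K) :
    ∫⁻ x, ENNReal.ofReal x ∂(shiftedWeibull a μ α (t / lam)) ≤ ENNReal.ofReal K +
      ENNReal.ofReal (K / c / c) *
        (1 + ∫⁻ x, ENNReal.ofReal (x ^ (1 / c)) ∂(expMeasure 1)) := by
  have ha0 := hc.trans_le ha.1
  have hμ0 := hc.trans_le hμ.1
  have hl0 : 0 < lam := ha0.trans hlam.1
  refine (lintegral_shiftedWeibull_le ha0 hμ0 hc hα.1 (by positivity)).trans ?_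
  have hK : 0 < K := ht.trans_le htK
  have h1 : a * (t / lam) ≤ K := by
    rw [← mul_div_assoc, div_le_iff₀ hl0]
    nlinarith [hlam.1]
  have h2 : c ≤ lam := ha.1.trans hlam.1.le
  have h3 : c ≤ μ := hμ.1
  gcongr

end UniformBounds

/-! ### Concentration on either side of the critical time -/

section ReturnBounds

variable {n : ℕ} {a μ α lam ℓ : Fin n → ℝ} {t c g K δ : ℝ} {r : ℕ}

theorem expectedReturn_le_mul_sum (ha : ∀ i, 0 < a i) (hμ : ∀ i, 0 < μ i) (hα : ∀ i, 0 < α i)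
    (hlam : ∀ i, IsHCMMRate (a i) (μ i) (α i) (lam i)) (ht : 0 < t) (hℓ : ∀ i, 0 ≤ ℓ i) :
    expectedReturn a μ α ℓ t ≤ t * ∑ i, returnRate (a i) (μ i) (α i) (lam i) := by
  rw [expectedReturn_eq_sum, Finset.mul_sum]
  exact Finset.sum_le_sum fun i _ =>
    load_mul_shiftedWeibull_Iic_le (ha i) (hμ i) (hα i) (hlam i) ht (hℓ i)

theorem expectedReturn_div_eq_mul_sum (ha : ∀ i, 0 < a i) (hμ : ∀ i, 0 < μ i)
    (hα : ∀ i, 0 < α i) (hlam : ∀ i, IsHCMMRate (a i) (μ i) (α i) (lam i)) (ht : 0 < t) :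
    expectedReturn a μ α (fun i => t / lam i) t =
      t * ∑ i, returnRate (a i) (μ i) (α i) (lam i) := by
  rw [expectedReturn_eq_sum, Finset.mul_sum]
  exact Finset.sum_congr rfl fun i _ =>
    load_mul_shiftedWeibull_Iic_eq (ha i) (hμ i) (hα i) (hlam i) ht

/-- Before the time at which the largest possible expected return reaches `r`, the return is
unlikely to reach `r`, whatever the loads are. -/
theorem measureReal_le_aggregateReturn_le (hc : 0 < c) (ha : ∀ i, c ≤ a i) (hμ : ∀ i, 0 < μ i)
    (hα : ∀ i, 0 < α i) (hlam : ∀ i, IsHCMMRate (a i) (μ i) (α i) (lam i)) (hg : 0 < g)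
    (hgr : ∀ i, g ≤ returnRate (a i) (μ i) (α i) (lam i)) (ht : 0 < t) (htK : t ≤ K)
    (hδ : 0 < δ) (hr : (t + δ) * ∑ i, returnRate (a i) (μ i) (α i) (lam i) ≤ r)
    (hℓ : ∀ i, 0 ≤ ℓ i) :
    (runTimeLaw a μ α ℓ).real {T | (r : ℝ) ≤ aggregateReturn ℓ T t} ≤
      Real.exp (-(2 * (δ * (n * g)) ^ 2) / (n * (K / c) ^ 2)) := by
  have ha0 : ∀ i, 0 < a i := fun i => hc.trans_le (ha i)
  have hK : 0 < K := ht.trans_le htK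
  have hs : n * g ≤ ∑ i, returnRate (a i) (μ i) (α i) (lam i) := by
    simpa using Finset.card_nsmul_le_sum Finset.univ _ g fun i _ => hgr i
  -- Each return is at most `t / a i ≤ K / c`, and the mean misses `r` by at least δ times the sum
  -- of rates, hence by `δ * (n * g)`.
  refine le_trans (measureReal_mono ?_) (measureReal_aggregateReturn_ge_le (t := t) (K := K / c)
    (x := δ * (n * g)) ha0 hμ hℓ (by positivity) (fun i => ?_) (by positivity))
  · intro T hT
    have h1 := expectedReturn_le_mul_sum (t := t) ha0 hμ hα hlam ht hℓ
    have h2 : δ * (n * g) ≤ δ * ∑ i, returnRate (a i) (μ i) (α i) (lam i) := by gcongr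
    simp only [Set.mem_ofPred_eq] at hT ⊢
    linarith
  · rw [div_mul_eq_mul_div, le_div_iff₀ hc]
    exact mul_le_mul htK (ha i) hc.le hK.le

/-- After the time at which the largest possible expected return reaches `r`, the loads that
maximize the expected return are likely to reach `r`. -/
theorem measureReal_aggregateReturn_div_lt_le (hc : 0 < c) (ha : ∀ i, c ≤ a i)
    (hμ : ∀ i, 0 < μ i) (hα : ∀ i, 0 < α i)
    (hlam : ∀ i, IsHCMMRate (a i) (μ i) (α i) (lam i)) (hg : 0 < g)
    (hgr : ∀ i, g ≤ returnRate (a i) (μ i) (α i) (lam i)) (ht : 0 < t) (htK : t ≤ K)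
    (hδ : 0 < δ) (hr : r ≤ (t - δ) * ∑ i, returnRate (a i) (μ i) (α i) (lam i)) :
    (runTimeLaw a μ α fun i => t / lam i).real
      {T | aggregateReturn (fun i => t / lam i) T t < (r : ℝ)} ≤
      Real.exp (-(2 * (δ * (n * g)) ^ 2) / (n * (K / c) ^ 2)) := by
  have ha0 : ∀ i, 0 < a i := fun i => hc.trans_le (ha i)
  have hK : 0 < K := ht.trans_le htK
  have hs : n * g ≤ ∑ i, returnRate (a i) (μ i) (α i) (lam i) := by
    simpa using Finset.card_nsmul_le_sum Finset.univ _ g fun i _ => hgr i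
  refine le_trans (measureReal_mono ?_) (measureReal_aggregateReturn_le_le (t := t) (K := K / c)
    (x := δ * (n * g)) ha0 hμ (fun i => ?_) (by positivity) (fun i => ?_) (by positivity))
  · intro T hT
    have h1 := expectedReturn_div_eq_mul_sum (t := t) ha0 hμ hα hlam ht
    have h2 : δ * (n * g) ≤ δ * ∑ i, returnRate (a i) (μ i) (α i) (lam i) := by gcongr
    simp only [Set.mem_ofPred_eq] at hT ⊢
    linarith
  · exact (div_pos ht ((ha0 i).trans (hlam i).1)).le
  · rw [div_mul_eq_mul_div, le_div_iff₀ hc]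
    exact mul_le_mul htK (ha i) hc.le hK.le

end ReturnBounds

/-! ### Asymptotics of the critical, HCMM and optimal times -/

section Asymptotics

theorem exp_hoeffding_eq_exp_mul {n : ℕ} {δ g K c : ℝ} (hK : 0 < K) (hc : 0 < c) :
    Real.exp (-(2 * (δ * (n * g)) ^ 2) / (n * (K / c) ^ 2)) =
      Real.exp (-(2 * (g * c / K) ^ 2) * (δ ^ 2 * n)) := by
  congr 1
  rcases eq_or_ne (n : ℝ) 0 with h | h
  · simp [h]
  · field_simp

theorem tendsto_exp_hoeffding {δ g K c : ℝ} (hδ : 0 < δ) (hg : 0 < g) (hK : 0 < K) (hc : 0 < c) :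
    Tendsto (fun n : ℕ => Real.exp (-(2 * (δ * (n * g)) ^ 2) / (n * (K / c) ^ 2))) atTop
      (𝓝 0) := by
  simp_rw [exp_hoeffding_eq_exp_mul hK hc]
  refine Real.tendsto_exp_atBot.comp ?_
  refine Tendsto.const_mul_atTop_of_neg (by simp; positivity) ?_
  exact tendsto_natCast_atTop_atTop.const_mul_atTop (by positivity)

/-- The margin δ = (n + 1)^(-1/4) tends to 0, yet δ² n is of order √n, and exp(-κ√n) beats every
power of n. -/
theorem isLittleO_exp_hoeffding {g K c : ℝ} (hg : 0 < g) (hK : 0 < K) (hc : 0 < c) :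
    (fun n : ℕ => Real.exp (-(2 * ((1 / √√((n : ℝ) + 1)) * (n * g)) ^ 2) / (n * (K / c) ^ 2)))
      =o[atTop] fun n : ℕ => 1 / (n : ℝ) := by
  have hs : Tendsto (fun n : ℕ => √((n : ℝ) + 1)) atTop atTop :=
    Real.tendsto_sqrt_atTop.comp (tendsto_natCast_atTop_atTop.atTop_add tendsto_const_nhds)
  have hκ : 0 < (g * c / K) ^ 2 := by positivity
  -- The variable is √(n + 1), so the power -2 produces 1 / (n + 1).
  have h := (isLittleO_exp_neg_mul_rpow_atTop hκ (-2)).comp_tendsto hs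
  refine IsBigO.trans_isLittleO ?_ (h.trans_isBigO ?_)
  · refine IsBigO.of_bound 1 ?_
    filter_upwards [eventually_ge_atTop 1] with n hn
    have hn' : (1 : ℝ) ≤ n := by exact_mod_cast hn
    rw [exp_hoeffding_eq_exp_mul hK hc, Function.comp_apply, Real.norm_eq_abs, Real.abs_exp,
      Real.norm_eq_abs, Real.abs_exp, one_mul, Real.exp_le_exp]
    have h1 : 0 < √((n : ℝ) + 1) := Real.sqrt_pos.2 (by positivity)
    -- This is n + 1 ≤ 2n; the factor 2 in Hoeffding's exponent pays for it.
    have h2 : √((n : ℝ) + 1) ≤ 2 * ((1 / √√((n : ℝ) + 1)) ^ 2 * n) := by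
      rw [div_pow, one_pow, Real.sq_sqrt h1.le, ← mul_assoc, mul_one_div, div_mul_eq_mul_div,
        le_div_iff₀ h1, Real.mul_self_sqrt (by positivity)]
      linarith
    nlinarith
  · refine IsBigO.of_bound 1 ?_
    filter_upwards [eventually_ge_atTop 1] with n hn
    have hn' : (1 : ℝ) ≤ n := by exact_mod_cast hn
    have : √((n : ℝ) + 1) ^ (-2 : ℝ) = 1 / ((n : ℝ) + 1) := by
      rw [Real.rpow_neg (by positivity)]
      norm_num [Real.sq_sqrt (by positivity : (0 : ℝ) ≤ (n : ℝ) + 1)]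
    rw [Function.comp_apply, this, one_mul, Real.norm_of_nonneg (by positivity),
      Real.norm_of_nonneg (by positivity)]
    gcongr
    linarith

/-- The time at which the largest possible expected return reaches `r`. -/
noncomputable def criticalTime {n : ℕ} (a μ α lam : Fin n → ℝ) (r : ℕ) : ℝ :=
  r / ∑ i, returnRate (a i) (μ i) (α i) (lam i)

/-- The rates `lam` are the HCMM rates of clusters with parameters between `c` and `C`, and all
return rates are at least `g`. -/
structure UniformClusters (a μ α lam : (n : ℕ) → Fin n → ℝ) (c C g : ℝ) : Prop where
  pos : 0 < c
  rate_pos : 0 < g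
  mem_Icc : ∀ n i, a n i ∈ Set.Icc c C ∧ μ n i ∈ Set.Icc c C ∧ α n i ∈ Set.Icc c C
  isHCMMRate : ∀ n i, IsHCMMRate (a n i) (μ n i) (α n i) (lam n i)
  le_returnRate : ∀ n i, g ≤ returnRate (a n i) (μ n i) (α n i) (lam n i)

namespace UniformClusters

variable {a μ α lam ℓ : (n : ℕ) → Fin n → ℝ} {c C g : ℝ} {r : ℕ → ℕ} {t : ℕ → ℝ}

theorem a_pos (h : UniformClusters a μ α lam c C g) (n : ℕ) (i : Fin n) : 0 < a n i :=
  h.pos.trans_le (h.mem_Icc n i).1.1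

theorem mu_pos (h : UniformClusters a μ α lam c C g) (n : ℕ) (i : Fin n) : 0 < μ n i :=
  h.pos.trans_le (h.mem_Icc n i).2.1.1

theorem alpha_pos (h : UniformClusters a μ α lam c C g) (n : ℕ) (i : Fin n) : 0 < α n i :=
  h.pos.trans_le (h.mem_Icc n i).2.2.1

theorem mul_le_sum_returnRate (h : UniformClusters a μ α lam c C g) (n : ℕ) :
    n * g ≤ ∑ i, returnRate (a n i) (μ n i) (α n i) (lam n i) := by
  simpa using Finset.card_nsmul_le_sum Finset.univ _ g fun i _ => h.le_returnRate n i

theorem criticalTime_nonneg (h : UniformClusters a μ α lam c C g) (n : ℕ) :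
    0 ≤ criticalTime (a n) (μ n) (α n) (lam n) (r n) := by
  have := h.rate_pos
  exact div_nonneg (r n).cast_nonneg ((by positivity : 0 ≤ n * g).trans (h.mul_le_sum_returnRate n))

theorem sum_returnRate_pos (h : UniformClusters a μ α lam c C g) {n : ℕ} (hn : 1 ≤ n) :
    0 < ∑ i, returnRate (a n i) (μ n i) (α n i) (lam n i) :=
  (mul_pos (by exact_mod_cast hn) h.rate_pos).trans_le (h.mul_le_sum_returnRate n)

theorem criticalTime_mul (h : UniformClusters a μ α lam c C g) {n : ℕ} (hn : 1 ≤ n) :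
    criticalTime (a n) (μ n) (α n) (lam n) (r n) *
      ∑ i, returnRate (a n i) (μ n i) (α n i) (lam n i) = r n :=
  div_mul_cancel₀ _ (h.sum_returnRate_pos hn).ne'

theorem exists_criticalTime_le (h : UniformClusters a μ α lam c C g)
    (hr : (fun n => (r n : ℝ)) =O[atTop] fun n => (n : ℝ)) :
    ∃ K > 0, ∀ᶠ n in atTop, criticalTime (a n) (μ n) (α n) (lam n) (r n) ≤ K := by
  obtain ⟨D, hD, hb⟩ := hr.exists_pos
  have := h.rate_pos
  refine ⟨D / g, by positivity, ?_⟩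
  filter_upwards [hb.bound, eventually_ge_atTop 1] with n h1 hn
  rw [Real.norm_natCast, Real.norm_natCast] at h1
  rw [criticalTime, div_le_div_iff₀ (h.sum_returnRate_pos hn) this]
  calc (r n : ℝ) * g ≤ D * n * g := by gcongr
    _ = D * (n * g) := by ring
    _ ≤ _ := by gcongr; exact h.mul_le_sum_returnRate n

theorem isReturnMaximizer_iff (h : UniformClusters a μ α lam c C g) {n : ℕ} {t : ℝ} (ht : 0 < t)
    {ℓ : Fin n → ℝ} :
    IsReturnMaximizer (a n) (μ n) (α n) t ℓ ↔ ℓ = fun i => t / lam n i :=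
  _root_.isReturnMaximizer_iff (h.a_pos n) (h.mu_pos n) (h.alpha_pos n) (h.isHCMMRate n) ht

/-- The threshold for `n` precedes `t` and `ℓ`, as it must to apply to unknown optimal loads and
feasible times. -/
theorem eventually_measureReal_le (h : UniformClusters a μ α lam c C g)
    (hr : (fun n => (r n : ℝ)) =O[atTop] fun n => (n : ℝ)) {δ η : ℝ} (hδ : 0 < δ) (hη : 0 < η) :
    ∀ᶠ n in atTop, ∀ t, 0 < t → t + δ ≤ criticalTime (a n) (μ n) (α n) (lam n) (r n) →
      ∀ ℓ : Fin n → ℝ, (∀ i, 0 ≤ ℓ i) →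
      (runTimeLaw (a n) (μ n) (α n) ℓ).real {T | (r n : ℝ) ≤ aggregateReturn ℓ T t} ≤ η := by
  obtain ⟨K, hK, hτ⟩ := h.exists_criticalTime_le hr
  filter_upwards [hτ, eventually_ge_atTop 1,
    (tendsto_exp_hoeffding hδ h.rate_pos hK h.pos).eventually_le_const hη] with n h1 hn h2
  intro t ht htδ ℓ hℓ
  refine le_trans (measureReal_le_aggregateReturn_le h.pos (fun i => (h.mem_Icc n i).1.1)
    (h.mu_pos n) (h.alpha_pos n) (h.isHCMMRate n) h.rate_pos (h.le_returnRate n) ht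
    (by linarith) hδ ?_ hℓ) h2
  rw [← h.criticalTime_mul (r := r) hn]
  have := h.sum_returnRate_pos hn
  gcongr

theorem measureReal_lt_eq_one_sub {n : ℕ} {a μ α ℓ : Fin n → ℝ} {t : ℝ} {r : ℕ} :
    (runTimeLaw a μ α ℓ).real {T | aggregateReturn ℓ T t < (r : ℝ)} =
      1 - (runTimeLaw a μ α ℓ).real {T | (r : ℝ) ≤ aggregateReturn ℓ T t} := by
  rw [← probReal_compl_eq_one_sub (measurableSet_le measurable_const measurable_aggregateReturn)]
  congr 1
  ext T
  simp

/-- At a time earlier by more than δ the shortfall probability would be at least 1/2, but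
feasibility makes it tend to 0. -/
theorem criticalTime_le_of_isAltFeasible (h : UniformClusters a μ α lam c C g)
    (hr : (fun n => (r n : ℝ)) =O[atTop] fun n => (n : ℝ))
    (hf : IsAltFeasible a μ α r t ℓ) {δ : ℝ} (hδ : 0 < δ) :
    ∀ᶠ n in atTop, criticalTime (a n) (μ n) (α n) (lam n) (r n) ≤ t n + δ := by
  have h0 := hf.2.2.trans_tendsto tendsto_one_div_atTop_nhds_zero_nat
  filter_upwards [h0.eventually_lt_const (by norm_num : (0 : ℝ) < 1 / 2),
    h.eventually_measureReal_le hr hδ (by norm_num : (0 : ℝ) < 1 / 2)] with n h1 h2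
  by_contra! hlt
  have h3 := h2 (t n) (hf.1 n) hlt.le (ℓ n) (hf.2.1 n).1
  rw [measureReal_lt_eq_one_sub] at h1
  linarith

/-- Times slightly after the critical times are feasible for the alternative problem. -/
theorem isAltFeasible_criticalTime_add (h : UniformClusters a μ α lam c C g)
    (hr : (fun n => (r n : ℝ)) =O[atTop] fun n => (n : ℝ)) :
    IsAltFeasible a μ α r
      (fun n => criticalTime (a n) (μ n) (α n) (lam n) (r n) + 1 / √√((n : ℝ) + 1))
      fun n i => (criticalTime (a n) (μ n) (α n) (lam n) (r n) + 1 / √√((n : ℝ) + 1)) /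
        lam n i := by
  have hε : ∀ n : ℕ, 0 < 1 / √√((n : ℝ) + 1) := fun n => by positivity
  have hpos : ∀ n, 0 < criticalTime (a n) (μ n) (α n) (lam n) (r n) + 1 / √√((n : ℝ) + 1) :=
    fun n => add_pos_of_nonneg_of_pos (h.criticalTime_nonneg n) (hε n)
  refine ⟨hpos, fun n => (h.isReturnMaximizer_iff (hpos n)).2 rfl, ?_⟩
  obtain ⟨K, hK, hτ⟩ := h.exists_criticalTime_le hr
  refine IsBigO.trans_isLittleO ?_
    (isLittleO_exp_hoeffding h.rate_pos (by positivity : 0 < K + 1) h.pos)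
  refine IsBigO.of_bound 1 ?_
  filter_upwards [hτ, eventually_ge_atTop 1] with n h1 hn
  rw [Real.norm_of_nonneg measureReal_nonneg, Real.norm_eq_abs, Real.abs_exp, one_mul]
  refine measureReal_aggregateReturn_div_lt_le h.pos (fun i => (h.mem_Icc n i).1.1)
    (h.mu_pos n) (h.alpha_pos n) (h.isHCMMRate n) h.rate_pos (h.le_returnRate n) (hpos n)
    ?_ (hε n) ?_
  · have : 1 / √√((n : ℝ) + 1) ≤ 1 := by
      rw [div_le_one (by positivity)]
      exact Real.one_le_sqrt.2 (Real.one_le_sqrt.2 (by simp))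
    linarith
  · rw [add_sub_cancel_right, h.criticalTime_mul hn]

theorem tendsto_one_div_sqrt_sqrt :
    Tendsto (fun n : ℕ => 1 / √√((n : ℝ) + 1)) atTop (𝓝 0) := by
  simp_rw [one_div]
  exact tendsto_inv_atTop_zero.comp (Real.tendsto_sqrt_atTop.comp (Real.tendsto_sqrt_atTop.comp
    (tendsto_natCast_atTop_atTop.atTop_add tendsto_const_nhds)))

theorem exists_isHCMM (h : UniformClusters a μ α lam c C g)
    (hr : (fun n => (r n : ℝ)) =O[atTop] fun n => (n : ℝ)) : ∃ t ℓ, IsHCMM a μ α r t ℓ := by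
  refine ⟨_, _, h.isAltFeasible_criticalTime_add hr, fun t' ℓ' hf ε hε => ?_⟩
  filter_upwards [h.criticalTime_le_of_isAltFeasible hr hf (half_pos hε),
    tendsto_one_div_sqrt_sqrt.eventually_le_const (half_pos hε)] with n h1 h2
  linarith

theorem le_criticalTime_of_isHCMM (h : UniformClusters a μ α lam c C g)
    (hr : (fun n => (r n : ℝ)) =O[atTop] fun n => (n : ℝ)) (hH : IsHCMM a μ α r t ℓ) {δ : ℝ}
    (hδ : 0 < δ) :
    ∀ᶠ n in atTop, t n ≤ criticalTime (a n) (μ n) (α n) (lam n) (r n) + δ := by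
  filter_upwards [hH.2 _ _ (h.isAltFeasible_criticalTime_add hr) (δ / 2) (half_pos hδ),
    tendsto_one_div_sqrt_sqrt.eventually_le_const (half_pos hδ)] with n h1 h2
  linarith

theorem eventually_le_expectedCompletionTime (h : UniformClusters a μ α lam c C g)
    (hr : (fun n => (r n : ℝ)) =O[atTop] fun n => (n : ℝ)) {δ : ℝ} (hδ : 0 < δ) :
    ∀ᶠ n in atTop, ∀ ℓ : Fin n → ℝ, (∀ i, 0 ≤ ℓ i) →
      ENNReal.ofReal (criticalTime (a n) (μ n) (α n) (lam n) (r n) - δ) ≤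
        expectedCompletionTime (a n) (μ n) (α n) (r n) ℓ := by
  obtain ⟨K, hK, hτ⟩ := h.exists_criticalTime_le hr
  -- Half of δ pays for the earlier time, the other half for the lost probability `δ / 2 / K`,
  -- multiplied by a time of at most `K`.
  filter_upwards [hτ, h.eventually_measureReal_le hr (half_pos hδ)
    (by positivity : 0 < δ / 2 / K)] with n h1 h2
  intro ℓ hℓ
  set τ := criticalTime (a n) (μ n) (α n) (lam n) (r n)
  rcases le_or_gt (τ - δ / 2) 0 with h0 | h0
  · rw [ENNReal.ofReal_of_nonpos (by linarith)]
    exact zero_le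
  refine le_trans ?_ (ofReal_mul_le_expectedCompletionTime (t := τ - δ / 2) hℓ)
  have h3 := h2 (τ - δ / 2) h0 (by linarith) ℓ hℓ
  rw [← ofReal_measureReal, ← ENNReal.ofReal_mul h0.le]
  refine ENNReal.ofReal_le_ofReal ?_
  rw [measureReal_lt_eq_one_sub]
  have h4 : (τ - δ / 2) * (runTimeLaw (a n) (μ n) (α n) ℓ).real
      {T | (r n : ℝ) ≤ aggregateReturn ℓ T (τ - δ / 2)} ≤ K * (δ / 2 / K) :=
    mul_le_mul (by linarith) h3 measureReal_nonneg hK.le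
  rw [mul_div_cancel₀ _ hK.ne'] at h4
  linarith

theorem eventually_expectedCompletionTime_le (h : UniformClusters a μ α lam c C g)
    (hr : (fun n => (r n : ℝ)) =O[atTop] fun n => (n : ℝ)) (hH : IsHCMM a μ α r t ℓ) {δ : ℝ}
    (hδ : 0 < δ) :
    ∀ᶠ n in atTop, expectedCompletionTime (a n) (μ n) (α n) (r n) (ℓ n) ≤
      ENNReal.ofReal (criticalTime (a n) (μ n) (α n) (lam n) (r n) + δ) := by
  obtain ⟨K, hK, hτ⟩ := h.exists_criticalTime_le hr
  set q : ℝ≥0∞ := ENNReal.ofReal (Real.exp (-(max 1 (C / g)) ^ C)) with hq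
  have hq0 : q ≠ 0 := by simp [hq, Real.exp_pos]
  set M : ℝ≥0∞ := ENNReal.ofReal (K + 1) + ENNReal.ofReal ((K + 1) / c / c) *
    (1 + ∫⁻ x, ENNReal.ofReal (x ^ (1 / c)) ∂(expMeasure 1)) with hM
  have hMtop : M ≠ ∞ := by
    have := lintegral_rpow_expMeasure_ne_top (one_div_pos.2 h.pos)
    finiteness
  have hP := hH.1.2.2
  -- The constraint o(1/n) exactly cancels the number of workers, since `q` and `M` do not depend on
  -- `n`.
  have hbad : Tendsto (fun n : ℕ => (n : ℝ≥0∞) * (runTimeLaw (a n) (μ n) (α n) (ℓ n)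
      {T | aggregateReturn (ℓ n) T (t n) < (r n : ℝ)} / q * M)) atTop (𝓝 0) := by
    have h1 : Tendsto (fun n : ℕ => ENNReal.ofReal (n * (runTimeLaw (a n) (μ n) (α n) (ℓ n)).real
        {T | aggregateReturn (ℓ n) T (t n) < (r n : ℝ)}) * (q⁻¹ * M)) atTop (𝓝 0) := by
      have h2 := hP.tendsto_div_nhds_zero
      have h3 := ENNReal.tendsto_ofReal h2
      have h4 := ENNReal.Tendsto.mul_const (b := q⁻¹ * M) h3 (Or.inr (by finiteness))
      rw [ENNReal.ofReal_zero, zero_mul] at h4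
      refine h4.congr fun n => ?_
      simp [mul_comm]
    refine h1.congr fun n => ?_
    rw [ENNReal.ofReal_mul n.cast_nonneg, ofReal_measureReal, ENNReal.ofReal_natCast,
      div_eq_mul_inv]
    ring
  filter_upwards [hτ, h.le_criticalTime_of_isHCMM hr hH one_pos,
    h.le_criticalTime_of_isHCMM hr hH (half_pos hδ),
    hbad.eventually_le_const (by simpa using hδ : 0 < ENNReal.ofReal (δ / 2)),
    (hP.trans_tendsto tendsto_one_div_atTop_nhds_zero_nat).eventually_lt_const one_pos]
    with n h1 h2 h3 h4 h5
  have ht := hH.1.1 n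
  have hℓ := (h.isReturnMaximizer_iff ht).1 (hH.1.2.1 n)
  have hℓ0 := (hH.1.2.1 n).1
  -- With total load below `r` a shortfall would be certain, against its probability being below 1.
  have hsum : (r n : ℝ) ≤ ∑ i, ℓ n i := by
    by_contra! hlt
    have : {T | aggregateReturn (ℓ n) T (t n) < (r n : ℝ)} = Set.univ := by
      refine Set.eq_univ_of_forall fun T => lt_of_le_of_lt ?_ hlt
      refine Finset.sum_le_sum fun i _ => ?_
      split_ifs
      exacts [le_rfl, hℓ0 i]
    rw [this] at h5
    simp at h5
  refine (expectedCompletionTime_le (q := q) (M := M) (h.a_pos n) (h.mu_pos n) hℓ0 ht.le hsum hq0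
    (fun i => ?_) fun i => ?_).trans ?_
  · rw [hℓ]
    exact le_shiftedWeibull_Ioi h.pos (h.mem_Icc n i).1 (h.mem_Icc n i).2.1 (h.mem_Icc n i).2.2
      (h.isHCMMRate n i) h.rate_pos (h.le_returnRate n i) ht
  · rw [hℓ]
    exact lintegral_shiftedWeibull_div_le h.pos (h.mem_Icc n i).1 (h.mem_Icc n i).2.1
      (h.mem_Icc n i).2.2 (h.isHCMMRate n i) ht (by linarith)
  · calc _ ≤ ENNReal.ofReal (criticalTime (a n) (μ n) (α n) (lam n) (r n) + δ / 2) +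
          ENNReal.ofReal (δ / 2) := add_le_add (ENNReal.ofReal_le_ofReal h3) h4
      _ = _ := by
          have := h.criticalTime_nonneg (r := r) n
          rw [← ENNReal.ofReal_add (by positivity) (by positivity)]
          congr 1
          ring

end UniformClusters

/-- Since `g ≤ f`, truncated subtraction is the true difference where both are finite, and adding or
removing it preserves limits, infinite ones included. -/
theorem tendsto_iff_of_tendsto_toReal_sub_zero {f g : ℕ → ℝ≥0∞}
    (hfin : ∀ᶠ n in atTop, f n < ∞ ∧ g n < ∞) (hgf : ∀ n, g n ≤ f n)
    (h : Tendsto (fun n => (f n).toReal - (g n).toReal) atTop (𝓝 0)) (L : ℝ≥0∞) :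
    Tendsto f atTop (𝓝 L) ↔ Tendsto g atTop (𝓝 L) := by
  have hd := ENNReal.tendsto_ofReal h
  rw [ENNReal.ofReal_zero] at hd
  have heq : ∀ᶠ n in atTop, f n - g n = ENNReal.ofReal ((f n).toReal - (g n).toReal) := by
    filter_upwards [hfin] with n hn
    rw [← ENNReal.toReal_sub_of_le (hgf n) hn.1.ne, ENNReal.ofReal_toReal (ENNReal.sub_ne_top hn.1.ne)]
  constructor <;> intro hL
  · have := ENNReal.Tendsto.sub hL hd (Or.inr ENNReal.zero_ne_top)
    rw [tsub_zero] at this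
    refine this.congr' ?_
    filter_upwards [hfin, heq] with n hn he
    rw [← he, ENNReal.sub_sub_cancel hn.1.ne (hgf n)]
  · have := hL.add hd
    rw [add_zero] at this
    refine this.congr' ?_
    filter_upwards [heq] with n he
    rw [← he, add_tsub_cancel_of_le (hgf n)]

end Asymptotics

/-! ### Assembly of the theorem -/

theorem theorem3 (a μ α : (n : ℕ) → Fin n → ℝ) (r : ℕ → ℕ)
    (ha : IsThetaOne a) (hμ : IsThetaOne μ) (hα : IsThetaOne α)
    (hr : (fun n => (r n : ℝ)) =Θ[atTop] fun n => (n : ℝ)) :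
    -- the loads that maximize the expected aggregate return are `t / λᵢ`
    (∃ lam : (n : ℕ) → Fin n → ℝ,
      (∀ n i x, IsHCMMRate (a n i) (μ n i) (α n i) x ↔ x = lam n i) ∧
      ∀ n t, 0 < t → ∀ ℓ : Fin n → ℝ,
        IsReturnMaximizer (a n) (μ n) (α n) t ℓ ↔ ℓ = fun i => t / lam n i) ∧
    -- the alternative problem and the main problem have solutions
    (∃ t ℓ, IsHCMM a μ α r t ℓ) ∧
    (∀ n, ∃ ℓ, IsOptimalAllocation (a n) (μ n) (α n) (r n) ℓ) ∧
    -- asymptotic optimality of every HCMM load allocation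
    ∀ (t : ℕ → ℝ) (ℓ ℓopt : (n : ℕ) → Fin n → ℝ), IsHCMM a μ α r t ℓ →
      (∀ n, IsOptimalAllocation (a n) (μ n) (α n) (r n) (ℓopt n)) →
      (∀ᶠ n in atTop, expectedCompletionTime (a n) (μ n) (α n) (r n) (ℓ n) < ∞ ∧
        expectedCompletionTime (a n) (μ n) (α n) (r n) (ℓopt n) < ∞) ∧
      Tendsto (fun n => (expectedCompletionTime (a n) (μ n) (α n) (r n) (ℓ n)).toReal -
        (expectedCompletionTime (a n) (μ n) (α n) (r n) (ℓopt n)).toReal) atTop (𝓝 0) ∧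
      ∀ L : ℝ≥0∞,
        Tendsto (fun n => expectedCompletionTime (a n) (μ n) (α n) (r n) (ℓ n)) atTop (𝓝 L) ↔
        Tendsto (fun n => expectedCompletionTime (a n) (μ n) (α n) (r n) (ℓopt n)) atTop (𝓝 L) := by

  obtain ⟨c, C, hc, hcC, hbox⟩ := ha.exists_common_bounds hμ hα
  obtain ⟨g, hg, hgr⟩ := exists_forall_le_returnRate hc hcC
  choose lam hlam using fun n i => existsUnique_isHCMMRate (hc.trans_le (hbox n i).1.1)
    (hc.trans_le (hbox n i).2.1.1) (hc.trans_le (hbox n i).2.2.1)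
  have hrate : ∀ n i, IsHCMMRate (a n i) (μ n i) (α n i) (lam n i) := fun n i =>
    (hlam n i _).2 rfl
  have h : UniformClusters a μ α lam c C g := ⟨hc, hg, hbox, hrate, fun n i =>
    hgr _ (hbox n i).1 _ (hbox n i).2.1 _ (hbox n i).2.2 _ (hrate n i)⟩
  refine ⟨⟨lam, hlam, fun n t ht ℓ => h.isReturnMaximizer_iff ht⟩, h.exists_isHCMM hr.1,
    fun n => exists_isOptimalAllocation (h.a_pos n) (h.mu_pos n), fun t ℓ ℓopt hH hopt => ?_⟩
  have hle : ∀ n, expectedCompletionTime (a n) (μ n) (α n) (r n) (ℓopt n) ≤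
      expectedCompletionTime (a n) (μ n) (α n) (r n) (ℓ n) := fun n =>
    (hopt n).2 _ (hH.1.2.1 n).1
  have hfin : ∀ᶠ n in atTop, expectedCompletionTime (a n) (μ n) (α n) (r n) (ℓ n) < ∞ ∧
      expectedCompletionTime (a n) (μ n) (α n) (r n) (ℓopt n) < ∞ := by
    filter_upwards [h.eventually_expectedCompletionTime_le hr.1 hH one_pos] with n hn
    have := hn.trans_lt ENNReal.ofReal_lt_top
    exact ⟨this, (hle n).trans_lt this⟩
  have hlim : Tendsto (fun n => (expectedCompletionTime (a n) (μ n) (α n) (r n) (ℓ n)).toReal -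
      (expectedCompletionTime (a n) (μ n) (α n) (r n) (ℓopt n)).toReal) atTop (𝓝 0) := by
    rw [Metric.tendsto_nhds]
    intro ε hε
    -- The HCMM expectation is at most `ε / 3` above the critical time and the optimal one at most
    -- `ε / 3` below it.
    filter_upwards [hfin, h.eventually_expectedCompletionTime_le hr.1 hH
      (by positivity : 0 < ε / 3), h.eventually_le_expectedCompletionTime hr.1
      (by positivity : 0 < ε / 3)] with n h1 h2 h3
    have h4 := ENNReal.toReal_mono h1.1.ne (hle n)
    have h5 := ENNReal.toReal_le_of_le_ofReal
      (add_nonneg (h.criticalTime_nonneg n) (by positivity)) h2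
    have h6 := (ENNReal.ofReal_le_iff_le_toReal h1.2.ne).1 (h3 _ (hopt n).1)
    rw [Real.dist_eq, sub_zero, abs_of_nonneg (sub_nonneg.2 h4)]
    linarith
  exact ⟨hfin, hlim, tendsto_iff_of_tendsto_toReal_sub_zero hfin hle hlim⟩
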